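/- Let $n\ge 0$ be an integer and $\boldsymbol S\in\mathbb R^{n\times n}$, and let $\lambda_1\ge 0$, $\lambda_2\ge 0$, $\gamma>0$. Index the coordinates of $\boldsymbol w\in\mathbb R^{n(n-1)/2}$ by the pairs $(i,j)$ with $1\le i<j\le n$, let $L:\mathbb R^{n(n-1)/2}\to\mathbb R^{n\times n}$ be the linear operator that maps $\boldsymbol w$ to the combinatorial graph Laplacian $\mathrm{diag}(\boldsymbol W\boldsymbol 1)-\boldsymbol W$ of the symmetric zero-diagonal matrix $\boldsymbol W$ with strictly upper triangular entries $w_{i,j}$, let $\boldsymbol J=\frac1n\boldsymbol 1\boldsymbol 1^T$, and let $C$ be the nonnegative orthant with indicator function $\iota_C$. The spaces carry the Euclidean and the Frobenius inner product. Consider $$\mathrm P_2:\ \min_{\boldsymbol w\in\mathbb R^{n(n-1)/2}} F(\boldsymbol w)+G(\boldsymbol w)+H(L(\boldsymbol w)),$$ $$F(\boldsymbol w)=-\lambda_1\,{}^{\gamma}\|\cdot\|_1(\boldsymbol w)+\tfrac{\lambda_2}{2}\|\boldsymbol w\|_2^2,\quad G(\boldsymbol w)=\iota_C(\boldsymbol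 w)+\lambda_1\|\boldsymbol w\|_1+\langle \boldsymbol S,L(\boldsymbol w)\rangle,\quad H(\boldsymbol X)=-\log\det(\boldsymbol X+\boldsymbol J),$$ where ${}^{\gamma}\|\cdot\|_1(\boldsymbol w)=\min_{\boldsymbol y}\bigl(\|\boldsymbol y\|_1+\frac1{2\gamma}\|\boldsymbol w-\boldsymbol y\|_2^2\bigr)$ and $H(\boldsymbol X)=+\infty$ unless $\boldsymbol X+\boldsymbol J$ is symmetric positive definite. Suppose that $\lambda_2\ge\gamma^{-1}\lambda_1$. Then $F$ is convex; moreover $F$ is differentiable, $\nabla F$ is $\lambda_2$-Lipschitz, and $\|L\|^2=2n$ for $n\ge 2$, where $\|L\|$ is the operator norm. Further let $\tau,\sigma>0$, let $(\rho_k)_{k\ge0}$ be real numbers, and suppose that the following conditions hold. 1. $\frac1\tau\ge 2\sigma n+\frac{\lambda_2}{2}$ and $\frac1\tau>2\sigma n$ (the second inequality follows from the first if $\lambda_2>0$). 2. $0<\rho_k<\delta$ for all $k$, where $\delta:=2-\frac{\lambda_2}{2}\bigl(\frac1\tau-2\sigma n\bigr)^{-1}$. 3. $\sum_k\rho_k(\delta-\rho_k)=+\infty$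 (which holds, for instance, if $\rho_k$ does not depend on $k$). 4. If $\lambda_2=0$, then $\mathrm P_2$ has a global minimizer. Then, for all $\boldsymbol w_0\in\mathbb R^{n(n-1)/2}$ and $\boldsymbol V_0\in\mathbb R^{n\times n}$, the sequence $(\boldsymbol w_k)$ generated by the primal-dual splitting method $$\tilde{\boldsymbol w}_{k+1}=\mathrm{prox}_{\tau G}(\boldsymbol w_k-\tau\nabla F(\boldsymbol w_k)-\tau L^*\boldsymbol V_k),\qquad \tilde{\boldsymbol V}_{k+1}=\mathrm{prox}_{\sigma H^*}(\boldsymbol V_k+\sigma L(2\tilde{\boldsymbol w}_{k+1}-\boldsymbol w_k)),$$ $$(\boldsymbol w_{k+1},\boldsymbol V_{k+1})=\rho_k(\tilde{\boldsymbol w}_{k+1},\tilde{\boldsymbol V}_{k+1})+(1-\rho_k)(\boldsymbol w_k,\boldsymbol V_k)$$ converges to a global minimizer of $\mathrm P_2$. Here $H^*$ is the convex conjugate of $H$, and $\mathrm{prox}_{\gamma f}(\boldsymbol w)$ is the minimizer of $\boldsymbol y\mapsto f(\boldsymbol y)+\frac1{2\gamma}\|\boldsymbol w-\boldsymbol y\|_2^2$.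 -/

import Mathlib

open Filter Topology

noncomputable section

namespace GraphLearning

section ConvexAnalysis

variable {X Y : Type*} [NormedAddCommGroup X] [InnerProductSpace ℝ X] [CompleteSpace X]
  [NormedAddCommGroup Y] [InnerProductSpace ℝ Y] [CompleteSpace Y]

/-- The Moreau envelope of index `γ` of a real-valued function that is bounded below:
`w ↦ inf_y (f y + ‖w - y‖² / (2γ))`. -/
def moreauEnvelope (γ : ℝ) (f : X → ℝ) (w : X) : ℝ :=
  ⨅ y : X, (f y + 1 / (2 * γ) * ‖w - y‖ ^ 2)

/-- The point `p` minimizes `y ↦ f y + ‖w - y‖² / (2γ)`. -/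
def IsProx (γ : ℝ) (f : X → EReal) (w p : X) : Prop :=
  ∀ y : X, f p + ((1 / (2 * γ) * ‖w - p‖ ^ 2 : ℝ) : EReal)
    ≤ f y + ((1 / (2 * γ) * ‖w - y‖ ^ 2 : ℝ) : EReal)

/-- The proximity operator `prox_{γ f}` of index `γ`: the minimizer of
`y ↦ f y + ‖w - y‖² / (2γ)`. -/
def prox (γ : ℝ) (f : X → EReal) (w : X) : X :=
  Classical.epsilon (IsProx γ f w)

/-- The convex conjugate `f* y = sup_x (⟪x, y⟫ - f x)`. -/
def conjugate (f : X → EReal) (y : X) : EReal :=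
  ⨆ x : X, (((inner ℝ x y : ℝ) : EReal) - f x)

/-- One iteration of the primal-dual splitting method for `min F + G + H ∘ L`, with proximity
parameters `τ`, `σ` and relaxation parameter `r`. -/
def pdsStep (F : X → ℝ) (G : X → EReal) (H : Y → EReal) (L : X →L[ℝ] Y) (τ σ r : ℝ)
    (z : X × Y) : X × Y :=
  let wt : X := prox τ G (z.1 - τ • gradient F z.1 - τ • ContinuousLinearMap.adjoint L z.2)
  let vt : Y := prox σ (conjugate H) (z.2 + σ • L ((2 : ℝ) • wt - z.1))
  (r • wt + (1 - r) • z.1, r • vt + (1 - r) • z.2)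

/-- The sequence of iterates `(w_k, V_k)` of the primal-dual splitting method started at
`(w₀, V₀) = z₀`, with relaxation parameters `ρ_k`. -/
def pdsIter (F : X → ℝ) (G : X → EReal) (H : Y → EReal) (L : X →L[ℝ] Y) (τ σ : ℝ)
    (ρ : ℕ → ℝ) (z₀ : X × Y) : ℕ → X × Y
  | 0 => z₀
  | k + 1 => pdsStep F G H L τ σ (ρ k) (pdsIter F G H L τ σ ρ z₀ k)

end ConvexAnalysis

/-- The `n(n-1)/2` positions `(i, j)` with `i < j` of the strict upper triangular part. -/
abbrev EdgeIdx (n : ℕ) : Type := {p : Fin n × Fin n // p.1 < p.2}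

/-- The space `ℝ^{n(n-1)/2}` of edge weights, with the Euclidean norm. -/
abbrev WeightSpace (n : ℕ) : Type := EuclideanSpace ℝ (EdgeIdx n)

/-- The space `ℝ^{n×n}` with the Frobenius norm and inner product. -/
abbrev MatSpace (n : ℕ) : Type := EuclideanSpace ℝ (Fin n × Fin n)

/-- An element of `MatSpace n` viewed as a matrix. -/
def toMat {n : ℕ} (V : MatSpace n) : Matrix (Fin n) (Fin n) ℝ :=
  Matrix.of fun i j => V (i, j)

/-- The symmetric weight matrix, with zero diagonal, of a vector of edge weights. -/
def weightMatrix {n : ℕ} (w : WeightSpace n) : Matrix (Fin n) (Fin n) ℝ :=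
  Matrix.of fun i j =>
    if h : i < j then w ⟨(i, j), h⟩ else if h' : j < i then w ⟨(j, i), h'⟩ else 0

/-- The combinatorial graph Laplacian `diag(W 1) - W` of a vector of edge weights. -/
def laplacian {n : ℕ} (w : WeightSpace n) : Matrix (Fin n) (Fin n) ℝ :=
  Matrix.diagonal (fun i => ∑ j, weightMatrix w i j) - weightMatrix w

theorem weightMatrix_add {n : ℕ} (w w' : WeightSpace n) :
    weightMatrix (w + w') = weightMatrix w + weightMatrix w' := by
  ext i j
  simp only [weightMatrix, Matrix.of_apply, Matrix.add_apply]
  split_ifs <;> simp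

theorem weightMatrix_smul {n : ℕ} (c : ℝ) (w : WeightSpace n) :
    weightMatrix (c • w) = c • weightMatrix w := by
  ext i j
  simp only [weightMatrix, Matrix.of_apply, Matrix.smul_apply]
  split_ifs <;> simp

/-- The linear operator `L : ℝ^{n(n-1)/2} → ℝ^{n×n}` that maps a weight vector to its Laplacian. -/
def laplacianOp (n : ℕ) : WeightSpace n →L[ℝ] MatSpace n :=
  LinearMap.toContinuousLinearMap
    { toFun := fun w => WithLp.toLp 2 fun p => laplacian w p.1 p.2
      map_add' := by
        intro w w'
        ext p
        simp only [laplacian, weightMatrix_add, Matrix.sub_apply, Matrix.add_apply,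
          Matrix.diagonal_apply, Finset.sum_add_distrib, PiLp.add_apply]
        split_ifs <;> ring
      map_smul' := by
        intro c w
        ext p
        simp only [laplacian, weightMatrix_smul, Matrix.sub_apply, Matrix.smul_apply,
          Matrix.diagonal_apply, PiLp.smul_apply, smul_eq_mul, RingHom.id_apply,
          ← Finset.mul_sum]
        split_ifs <;> ring }

/-- The `ℓ₁` norm. -/
def l1norm {n : ℕ} (w : WeightSpace n) : ℝ := ∑ e, |w e|

/-- The smooth part `F w = -λ₁ (^γ‖·‖₁)(w) + (λ₂ / 2) ‖w‖₂²`. -/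
def smoothPart (n : ℕ) (lam₁ lam₂ γ : ℝ) (w : WeightSpace n) : ℝ :=
  -lam₁ * moreauEnvelope γ l1norm w + lam₂ / 2 * ‖w‖ ^ 2

open Classical in
/-- The indicator function of the nonnegative cone `C`. -/
def indicatorCone {n : ℕ} (w : WeightSpace n) : EReal :=
  if ∀ e, 0 ≤ w e then 0 else ⊤

/-- The function `G w = ι_C w + λ₁ ‖w‖₁ + ⟨S, L w⟩`. -/
def nonsmoothPart {n : ℕ} (S : Matrix (Fin n) (Fin n) ℝ) (lam₁ : ℝ) (w : WeightSpace n) : EReal :=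
  indicatorCone w + ((lam₁ * l1norm w + ∑ i, ∑ j, S i j * laplacian w i j : ℝ) : EReal)

/-- The matrix `J = (1/n) 1 1ᵀ`. -/
def avgMatrix (n : ℕ) : Matrix (Fin n) (Fin n) ℝ := Matrix.of fun _ _ => 1 / (n : ℝ)

open Classical in
/-- The function `H X = -log det (X + J)`, with value `+∞` unless `X + J` is (symmetric) positive
definite. -/
def negLogDet {n : ℕ} (X : MatSpace n) : EReal :=
  if (toMat X + avgMatrix n).PosDef then ((-Real.log (toMat X + avgMatrix n).det : ℝ) : EReal)
  else ⊤

/-- The cost function `F + G + H ∘ L` of the graph learning problem. -/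
def cost {n : ℕ} (S : Matrix (Fin n) (Fin n) ℝ) (lam₁ lam₂ γ : ℝ) (w : WeightSpace n) : EReal :=
  (smoothPart n lam₁ lam₂ γ w : EReal) + nonsmoothPart S lam₁ w + negLogDet (laplacianOp n w)

/-- The point `w` is a global minimizer of the cost function. -/
def IsGlobalMinimizer {n : ℕ} (S : Matrix (Fin n) (Fin n) ℝ) (lam₁ lam₂ γ : ℝ)
    (w : WeightSpace n) : Prop :=
  ∀ w' : WeightSpace n, cost S lam₁ lam₂ γ w ≤ cost S lam₁ lam₂ γ w'

end GraphLearning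

end

/-! The Moreau envelope of the l1 norm is a sum of scalar Huber functions, each convex with a
`1/γ`-Lipschitz derivative. So `λ₂/2 t² - λ₁ huber` is convex when `λ₂ ≥ λ₁/γ`, and `∇F` is even
cocoercive (`smoothGrad_cocoercive`). For the Laplacian, `‖L w‖²` is the sum of the squared degrees
plus `2‖w‖²`; Cauchy–Schwarz bounds it by `2n‖w‖²`, with equality for the complete graph.

Convergence is a Fejér argument. Fixed points of the unrelaxed step are the saddle points, that is,
the solutions of the primal-dual optimality conditions. In the metric `τ⁻¹‖w‖² - 2⟪L w, V⟫ +
σ⁻¹‖V‖²`, positive definite because `σ‖L‖² < 1/τ`, monotonicity of subgradients and cocoercivity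
make a relaxed step decrease the squared distance to any saddle point by at least `ρ(δ - ρ)` times
the squared residual (`IsSaddle.metricSq_step_le`). As these factors are not summable, compactness
gives a cluster point that is a fixed point, and Fejér monotonicity makes it the limit.

A saddle point is obtained from a minimizer `w` with dual variable `-(L w + J)⁻¹`, by
differentiating along segments inside the cone; conversely the primal part of a saddle point is a
minimizer. If `λ₂ > 0`, quadratic growth provides a minimizer. Both resolvents are exhibited
explicitly, so no general theory of convex functions is needed. -/

noncomputable section

namespace GraphLearning

/-! ### Subgradients, proximity operators and the primal-dual metric. -/

section Subgradient

variable {X Y : Type*} [NormedAddCommGroup X] [InnerProductSpace ℝ X]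
  [NormedAddCommGroup Y] [InnerProductSpace ℝ Y]

/-- `u` is a subgradient of `f` at a point `x` where `f` is finite. -/
def HasSubgradient (f : X → EReal) (u x : X) : Prop :=
  ∃ r : ℝ, f x = r ∧ ∀ y, ((r + inner ℝ u (y - x) : ℝ) : EReal) ≤ f y

theorem HasSubgradient.monotone {f : X → EReal} {u x u' x' : X}
    (h : HasSubgradient f u x) (h' : HasSubgradient f u' x') :
    0 ≤ inner ℝ (u - u') (x - x') := by
  obtain ⟨r, hr, h⟩ := h
  obtain ⟨r', hr', h'⟩ := h'
  have h1 := h x'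
  have h2 := h' x
  rw [hr', EReal.coe_le_coe_iff] at h1
  rw [hr, EReal.coe_le_coe_iff] at h2
  simp only [inner_sub_left, inner_sub_right] at *
  linarith

/-- Equality in Fenchel–Young. This direction of the inversion needs neither convexity nor
closedness of `f`. -/
theorem HasSubgradient.conjugate {f : X → EReal} {u x : X} (h : HasSubgradient f u x) :
    HasSubgradient (conjugate f) x u := by
  obtain ⟨r, hr, h⟩ := h
  refine ⟨inner ℝ x u - r, le_antisymm (iSup_le fun y => ?_) ?_, fun v => ?_⟩
  · have hy := h y
    induction hfy : f y with
    | bot => rw [hfy] at hy; simp at hy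
    | top => simp
    | coe s =>
      rw [hfy, EReal.coe_le_coe_iff] at hy
      rw [← EReal.coe_sub, EReal.coe_le_coe_iff]
      rw [inner_sub_right, real_inner_comm, real_inner_comm x u] at hy
      linarith
  · refine le_trans ?_ (le_iSup (fun y => ((inner ℝ y u : ℝ) : EReal) - f y) x)
    rw [hr, ← EReal.coe_sub]
  · refine le_trans ?_ (le_iSup (fun y => ((inner ℝ y v : ℝ) : EReal) - f y) x)
    rw [hr, ← EReal.coe_sub, EReal.coe_le_coe_iff, inner_sub_right]
    linarith

/-- The prox objective exceeds its value at `p` by at least `‖y - p‖² / (2γ)`, so `p` is its only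
minimizer and the choice in `prox` is forced. -/
theorem prox_eq_of_hasSubgradient {γ : ℝ} (hγ : 0 < γ) {f : X → EReal} {w p : X}
    (h : HasSubgradient f (γ⁻¹ • (w - p)) p) : prox γ f w = p := by
  obtain ⟨r, hr, h⟩ := h
  have key : ∀ y : X, ((r + 1 / (2 * γ) * ‖w - p‖ ^ 2 + 1 / (2 * γ) * ‖y - p‖ ^ 2 : ℝ) : EReal) ≤
      f y + ((1 / (2 * γ) * ‖w - y‖ ^ 2 : ℝ) : EReal) := by
    intro y
    refine le_trans (le_of_eq ?_) (add_le_add_left (h y) _)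
    rw [← EReal.coe_add, EReal.coe_eq_coe_iff]
    have : w - y = (w - p) - (y - p) := by abel
    rw [this, norm_sub_sq_real (w - p), real_inner_smul_left]
    field_simp
    ring
  have hp : IsProx γ f w p := by
    intro y
    refine le_trans ?_ (key y)
    rw [hr, ← EReal.coe_add, EReal.coe_le_coe_iff]
    have : 0 ≤ 1 / (2 * γ) * ‖y - p‖ ^ 2 := by positivity
    linarith
  have hq : IsProx γ f w (prox γ f w) := Classical.epsilon_spec ⟨p, hp⟩
  have h1 := (key _).trans (hq p)
  rw [hr, ← EReal.coe_add, EReal.coe_le_coe_iff] at h1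
  have h2 : ‖prox γ f w - p‖ ^ 2 ≤ 0 := by
    have : 0 < 1 / (2 * γ) := by positivity
    by_contra hc
    push Not at hc
    nlinarith [mul_pos this hc]
  have h3 : ‖prox γ f w - p‖ = 0 := by
    have := sq_nonneg ‖prox γ f w - p‖
    exact pow_eq_zero_iff (two_ne_zero) |>.1 (le_antisymm h2 this)
  exact sub_eq_zero.1 (norm_eq_zero.1 h3)

/-- Here `p` is the resolvent `(b • id + a⁻¹ • ∂f)⁻¹`; monotonicity of `∂f` makes it
`b⁻¹`-Lipschitz. The two scalars cover the different normalizations used for `G` and `H`. -/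
theorem continuous_of_hasSubgradient {f : X → EReal} {a b : ℝ} (ha : 0 < a) (hb : 0 < b)
    {p : X → X} (hp : ∀ x, HasSubgradient f (a • (x - b • p x)) (p x)) : Continuous p := by
  have h : ∀ x y, b * ‖p x - p y‖ ≤ ‖x - y‖ := by
    intro x y
    have h1 := (hp x).monotone (hp y)
    rw [← smul_sub, real_inner_smul_left] at h1
    have h2 : 0 ≤ inner ℝ ((x - y) - b • (p x - p y)) (p x - p y) := by
      refine (mul_nonneg_iff_of_pos_left ha).1 (le_of_le_of_eq h1 ?_)
      congr 2
      rw [smul_sub]; abel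
    rw [inner_sub_left, real_inner_smul_left, real_inner_self_eq_norm_sq] at h2
    have h3 := real_inner_le_norm (x - y) (p x - p y)
    rcases (norm_nonneg (p x - p y)).eq_or_lt with h0 | h0
    · rw [← h0]; simp
    · nlinarith
  refine (LipschitzWith.of_dist_le_mul (K := (b⁻¹).toNNReal) fun x y => ?_).continuous
  rw [Real.coe_toNNReal _ (by positivity), dist_eq_norm, dist_eq_norm]
  have := h x y
  rw [inv_mul_eq_div, le_div_iff₀ hb]
  linarith


/-- The squared norm in which the primal-dual iteration is Fejér monotone. -/
def metricSq (L : X →L[ℝ] Y) (τ σ : ℝ) (z : X × Y) : ℝ :=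
  τ⁻¹ * ‖z.1‖ ^ 2 - 2 * inner ℝ (L z.1) z.2 + σ⁻¹ * ‖z.2‖ ^ 2

theorem continuous_metricSq (L : X →L[ℝ] Y) (τ σ : ℝ) : Continuous (metricSq L τ σ) := by
  unfold metricSq
  fun_prop

theorem fst_le_metricSq {L : X →L[ℝ] Y} {τ σ K : ℝ} (hσ : 0 < σ)
    (hL : ‖L‖ ^ 2 ≤ K) (z : X × Y) : (τ⁻¹ - σ * K) * ‖z.1‖ ^ 2 ≤ metricSq L τ σ z := by
  have h1 : ‖L z.1‖ ^ 2 ≤ K * ‖z.1‖ ^ 2 := by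
    calc ‖L z.1‖ ^ 2 ≤ (‖L‖ * ‖z.1‖) ^ 2 := by gcongr; exact L.le_opNorm _
      _ = ‖L‖ ^ 2 * ‖z.1‖ ^ 2 := by ring
      _ ≤ _ := by gcongr
  -- Completing the square in the second variable.
  have h2 : 0 ≤ σ⁻¹ * ‖σ • L z.1 - z.2‖ ^ 2 := by positivity
  rw [norm_sub_sq_real, real_inner_smul_left, norm_smul, Real.norm_of_nonneg hσ.le] at h2
  have h3 : σ⁻¹ * ((σ * ‖L z.1‖) ^ 2 - 2 * (σ * inner ℝ (L z.1) z.2) + ‖z.2‖ ^ 2) =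
      σ * ‖L z.1‖ ^ 2 - 2 * inner ℝ (L z.1) z.2 + σ⁻¹ * ‖z.2‖ ^ 2 := by
    field_simp
  rw [h3] at h2
  unfold metricSq
  nlinarith [mul_le_mul_of_nonneg_left h1 hσ.le]

end Subgradient

/-- A Fejér monotone sequence with non-degenerate decrease converges to a fixed point. -/
theorem exists_tendsto_fixedPoint_of_fejer {E : Type*} [NormedAddCommGroup E] [ProperSpace E]
    {Q : E → ℝ} (hQ : Continuous Q) (hQ0 : Q 0 = 0) {c : ℝ} (hc : 0 < c)
    (hQc : ∀ x, c * ‖x‖ ^ 2 ≤ Q x) {T : E → E} (hT : Continuous T) {z : ℕ → E} {ε : ℕ → ℝ}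
    (hε : ∀ k, 0 < ε k) (hsum : ¬ Summable ε)
    (hfejer : ∀ y, T y = y → ∀ k, Q (z (k + 1) - y) ≤ Q (z k - y) - ε k * Q (T (z k) - z k))
    (hfix : ∃ y, T y = y) : ∃ y, T y = y ∧ Tendsto z atTop (𝓝 y) := by
  have hQnn : ∀ x, 0 ≤ Q x := fun x => le_trans (by positivity) (hQc x)
  have hanti : ∀ y, T y = y → Antitone fun k => Q (z k - y) := fun y hy =>
    antitone_nat_of_succ_le fun k => by
      have := hfejer y hy k
      have := mul_nonneg (hε k).le (hQnn (T (z k) - z k))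
      linarith
  have hnorm : ∀ x, ‖x‖ ≤ Real.sqrt (Q x / c) := fun x =>
    Real.le_sqrt_of_sq_le ((le_div_iff₀ hc).2 (by linarith [hQc x]))
  obtain ⟨y, hy⟩ := hfix
  -- Were the residual eventually at least `η`, telescoping the Fejér inequality would make `ε`
  -- summable.
  have hfreq : ∀ η : ℝ, 0 < η → ∃ᶠ k in atTop, Q (T (z k) - z k) < η := by
    intro η hη hev
    refine hsum ?_
    have hs : Summable fun k => ε k * Q (T (z k) - z k) := by
      refine summable_of_sum_range_le (c := Q (z 0 - y))
        (fun k => mul_nonneg (hε k).le (hQnn _)) fun m => ?_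
      have : ∑ k ∈ Finset.range m, ε k * Q (T (z k) - z k) ≤ Q (z 0 - y) - Q (z m - y) := by
        induction m with
        | zero => simp
        | succ m ih => rw [Finset.sum_range_succ]; linarith [hfejer y hy m]
      linarith [hQnn (z m - y)]
    refine Summable.of_norm_bounded_eventually_nat (hs.mul_left η⁻¹) ?_
    filter_upwards [hev] with k hk
    rw [Real.norm_of_nonneg (hε k).le]
    rw [not_lt] at hk
    rw [inv_mul_eq_div, le_div_iff₀ hη]
    exact mul_le_mul_of_nonneg_left hk (hε k).le
  obtain ⟨φ, hφ, hφQ⟩ := extraction_forall_of_frequently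
    (fun m : ℕ => hfreq (1 / ((m : ℝ) + 1)) (by positivity))
  have hbd : ∀ k, z (φ k) ∈ Metric.closedBall y (Real.sqrt (Q (z 0 - y) / c)) := fun k => by
    rw [mem_closedBall_iff_norm]
    refine (hnorm _).trans (Real.sqrt_le_sqrt ?_)
    exact div_le_div_of_nonneg_right (hanti y hy (Nat.zero_le _)) hc.le
  obtain ⟨x, -, ψ, hψ, hx⟩ := (isCompact_closedBall y _).tendsto_subseq hbd
  have hTx : T x = x := by
    have h1 : Tendsto (fun k => Q (T (z (φ (ψ k))) - z (φ (ψ k)))) atTop (𝓝 (Q (T x - x))) :=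
      ((hQ.comp (hT.sub continuous_id)).tendsto x).comp hx
    have h2 : Tendsto (fun k => Q (T (z (φ (ψ k))) - z (φ (ψ k)))) atTop (𝓝 0) :=
      squeeze_zero (fun k => hQnn _) (fun k => (hφQ (ψ k)).le)
        (tendsto_one_div_add_atTop_nhds_zero_nat.comp hψ.tendsto_atTop)
    have h3 := hnorm (T x - x)
    rw [tendsto_nhds_unique h1 h2] at h3
    simp only [zero_div, Real.sqrt_zero, norm_le_zero_iff] at h3
    exact sub_eq_zero.1 h3
  refine ⟨x, hTx, ?_⟩
  -- The distance to the cluster point is antitone, so its limit along a subsequence, which is zero,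
  -- is the limit of the whole sequence.
  have h1 : Tendsto (fun k => Q (z (φ (ψ k)) - x)) atTop (𝓝 0) := by
    have := ((hQ.comp (continuous_id.sub (continuous_const (y := x)))).tendsto x).comp hx
    simpa [hQ0, Function.comp_def] using this
  have h2 : Tendsto (fun k => Q (z k - x)) atTop (𝓝 0) := by
    have hlim := tendsto_atTop_ciInf (hanti x hTx)
      ⟨0, by rintro _ ⟨k, rfl⟩; exact hQnn _⟩
    rwa [tendsto_nhds_unique (hlim.comp (hφ.comp hψ).tendsto_atTop) h1] at hlim
  rw [tendsto_iff_norm_sub_tendsto_zero]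
  refine squeeze_zero (fun _ => norm_nonneg _) (fun k => hnorm _) ?_
  simpa using (h2.div_const c).sqrt

/-! ### Convergence of the primal-dual splitting method. -/

section PrimalDual

variable {X Y : Type*} [NormedAddCommGroup X] [InnerProductSpace ℝ X] [FiniteDimensional ℝ X]
  [NormedAddCommGroup Y] [InnerProductSpace ℝ Y] [FiniteDimensional ℝ Y]

/-- The primal-dual optimality conditions for `min F + G + H ∘ L`, where `g` is the gradient
of `F`. -/
def IsSaddle (g : X → X) (G : X → EReal) (H : Y → EReal) (L : X →L[ℝ] Y) (z : X × Y) : Prop :=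
  HasSubgradient G (-g z.1 - ContinuousLinearMap.adjoint L z.2) z.1 ∧ HasSubgradient H z.2 (L z.1)

theorem snd_le_metricSq {L : X →L[ℝ] Y} {τ σ K : ℝ} (hτ : 0 < τ)
    (hL : ‖L‖ ^ 2 ≤ K) (z : X × Y) : (σ⁻¹ - τ * K) * ‖z.2‖ ^ 2 ≤ metricSq L τ σ z := by
  have := fst_le_metricSq (L := ContinuousLinearMap.adjoint L) (τ := σ) hτ (K := K)
    (by rwa [LinearIsometryEquiv.norm_map]) (z.2, z.1)
  refine this.trans (le_of_eq ?_)
  simp only [metricSq, ContinuousLinearMap.adjoint_inner_left]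
  rw [real_inner_comm]
  ring

theorem exists_mul_norm_sq_le_metricSq {L : X →L[ℝ] Y} {τ σ K : ℝ} (hτ : 0 < τ) (hσ : 0 < σ)
    (hL : ‖L‖ ^ 2 ≤ K) (hK : σ * K < τ⁻¹) :
    ∃ c, 0 < c ∧ ∀ z, c * ‖z‖ ^ 2 ≤ metricSq L τ σ z := by
  have hK' : τ * K < σ⁻¹ := by
    rw [← one_div, lt_div_iff₀ hτ] at hK
    rw [← one_div, lt_div_iff₀ hσ]
    linarith
  -- The product carries the max norm, so bounding the larger component is enough.
  refine ⟨min (τ⁻¹ - σ * K) (σ⁻¹ - τ * K), lt_min (by linarith) (by linarith), fun z => ?_⟩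
  rcases le_total ‖z.1‖ ‖z.2‖ with h | h
  · rw [Prod.norm_def, max_eq_right h]
    exact le_trans (by gcongr; exact min_le_right _ _) (snd_le_metricSq hτ hL z)
  · rw [Prod.norm_def, max_eq_left h]
    exact le_trans (by gcongr; exact min_le_left _ _) (fst_le_metricSq hσ hL z)

/-- A relaxed step decreases the distance to every saddle point. -/
theorem IsSaddle.metricSq_step_le {g : X → X} {G : X → EReal} {H : Y → EReal} {L : X →L[ℝ] Y}
    {τ σ β K : ℝ} (hσ : 0 < σ) (hβ : 0 ≤ β) (hL : ‖L‖ ^ 2 ≤ K) (hK : σ * K < τ⁻¹)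
    (hg : ∀ x y, ‖g x - g y‖ ^ 2 ≤ β * inner ℝ (g x - g y) (x - y))
    {s z t : X × Y} (hs : IsSaddle g G H L s)
    (h1 : HasSubgradient G (τ⁻¹ • (z.1 - t.1) - g z.1 - ContinuousLinearMap.adjoint L z.2) t.1)
    (h2 : HasSubgradient H t.2 (σ⁻¹ • (z.2 - t.2) + L ((2 : ℝ) • t.1 - z.1))) {r : ℝ} (hr : 0 ≤ r) :
    metricSq L τ σ ((r • t + (1 - r) • z) - s) ≤ metricSq L τ σ (z - s) -
      r * ((2 - β / 2 * (τ⁻¹ - σ * K)⁻¹) - r) * metricSq L τ σ (t - z) := by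
  have m1 := h1.monotone hs.1
  have m2 := h2.monotone hs.2
  -- The gradient is taken at `z.1` but tested at `t.1`. Young's inequality absorbs the mismatch
  -- into cocoercivity; `β/4` comes from minimizing `a²/β - a b` over `a`.
  have m3 : - (β / 4 * ‖t.1 - z.1‖ ^ 2) ≤ inner ℝ (g z.1 - g s.1) (t.1 - s.1) := by
    have := hg z.1 s.1
    have e : t.1 - s.1 = (t.1 - z.1) + (z.1 - s.1) := by abel
    rw [e, inner_add_right]
    have c := abs_le.1 (abs_real_inner_le_norm (g z.1 - g s.1) (t.1 - z.1))
    rcases hβ.eq_or_lt with h0 | h0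
    · rw [← h0] at this ⊢
      have h0' : ‖g z.1 - g s.1‖ = 0 := by
        have := sq_nonneg ‖g z.1 - g s.1‖
        exact pow_eq_zero_iff (two_ne_zero) |>.1 (by linarith)
      rw [norm_eq_zero.1 h0']
      simp
    · have hsq := sq_nonneg (‖g z.1 - g s.1‖ - β / 2 * ‖t.1 - z.1‖)
      have : 0 ≤ β * (inner ℝ (g z.1 - g s.1) (t.1 - z.1) + inner ℝ (g z.1 - g s.1) (z.1 - s.1)
        + β / 4 * ‖t.1 - z.1‖ ^ 2) := by
        nlinarith [mul_le_mul_of_nonneg_left c.1 h0.le]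
      have := (mul_nonneg_iff_of_pos_left h0).1 this
      linarith
  -- Measured in the metric and later multiplied by `2r`, this loss becomes the term subtracted from
  -- 2 in `δ`.
  have m4 : β / 4 * ‖t.1 - z.1‖ ^ 2 ≤ β / 4 * (τ⁻¹ - σ * K)⁻¹ * metricSq L τ σ (t - z) := by
    have := fst_le_metricSq (τ := τ) hσ hL (t - z)
    rw [mul_assoc]
    gcongr
    rw [inv_mul_eq_div, le_div_iff₀ (by linarith)]
    simpa [mul_comm] using this
  have m5 : 0 ≤ inner ℝ (τ⁻¹ • (z.1 - t.1)) (t.1 - s.1) - inner ℝ (g z.1 - g s.1) (t.1 - s.1)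
      - inner ℝ (L (t.1 - s.1)) (z.2 - t.2) + inner ℝ (σ⁻¹ • (z.2 - t.2)) (t.2 - s.2)
      - inner ℝ (L (z.1 - t.1)) (t.2 - s.2) := by
    refine le_trans (add_nonneg m1 m2) (le_of_eq ?_)
    simp only [inner_sub_left, inner_sub_right, inner_add_right, inner_smul_left,
      inner_smul_right, map_sub, map_smul, ContinuousLinearMap.adjoint_inner_left, inner_neg_left,
      conj_trivial]
    simp only [real_inner_comm]
    ring
  have m6 : metricSq L τ σ ((r • t + (1 - r) • z) - s) = metricSq L τ σ (z - s)
      + 2 * r * (- metricSq L τ σ (t - z) - (inner ℝ (τ⁻¹ • (z.1 - t.1)) (t.1 - s.1)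
      - inner ℝ (L (t.1 - s.1)) (z.2 - t.2) + inner ℝ (σ⁻¹ • (z.2 - t.2)) (t.2 - s.2)
      - inner ℝ (L (z.1 - t.1)) (t.2 - s.2))) + r ^ 2 * metricSq L τ σ (t - z) := by
    simp only [metricSq, ← real_inner_self_eq_norm_sq, Prod.fst_sub, Prod.snd_sub, Prod.fst_add,
      Prod.snd_add, Prod.smul_fst, Prod.smul_snd, inner_sub_left, inner_sub_right, inner_add_left,
      inner_add_right, inner_smul_left, inner_smul_right, map_sub, map_add, map_smul, conj_trivial]
    simp only [real_inner_comm]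
    ring
  rw [m6]
  have : 0 ≤ 2 * r * (inner ℝ (τ⁻¹ • (z.1 - t.1)) (t.1 - s.1)
      - inner ℝ (L (t.1 - s.1)) (z.2 - t.2) + inner ℝ (σ⁻¹ • (z.2 - t.2)) (t.2 - s.2)
      - inner ℝ (L (z.1 - t.1)) (t.2 - s.2) + β / 4 * (τ⁻¹ - σ * K)⁻¹ * metricSq L τ σ (t - z)) :=
    mul_nonneg (by linarith) (by linarith)
  linarith

/-- Convexity and closedness of `G` and `H` enter only through the existence of resolvents, `hG` and
`hH`. -/
theorem exists_tendsto_pdsIter {F : X → ℝ} {G : X → EReal} {H : Y → EReal} {L : X →L[ℝ] Y}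
    {τ σ β K : ℝ} (hσ : 0 < σ) (hτ : 0 < τ) (hβ : 0 ≤ β) (hL : ‖L‖ ^ 2 ≤ K) (hK : σ * K < τ⁻¹)
    (hg : ∀ x y, ‖gradient F x - gradient F y‖ ^ 2 ≤
      β * inner ℝ (gradient F x - gradient F y) (x - y)) (hgc : Continuous (gradient F))
    (hG : ∀ x, ∃ p, HasSubgradient G (τ⁻¹ • (x - p)) p)
    (hH : ∀ x, ∃ q, HasSubgradient H (x - σ • q) q)
    {ρ : ℕ → ℝ} (hρ : ∀ k, 0 < ρ k ∧ ρ k < 2 - β / 2 * (τ⁻¹ - σ * K)⁻¹)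
    (hsum : ¬ Summable fun k => ρ k * ((2 - β / 2 * (τ⁻¹ - σ * K)⁻¹) - ρ k))
    (hs : ∃ s, IsSaddle (gradient F) G H L s) (z₀ : X × Y) :
    ∃ s, IsSaddle (gradient F) G H L s ∧
      Tendsto (pdsIter F G H L τ σ ρ z₀) atTop (𝓝 s) := by
  choose p hp using hG
  choose q hq using hH
  have hpc : Continuous p := continuous_of_hasSubgradient (f := G) (a := τ⁻¹) (b := 1)
    (by positivity) one_pos (by simpa using hp)
  have hqc : Continuous q := continuous_of_hasSubgradient (f := H) (a := 1) (b := σ)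
    one_pos hσ (by simpa using hq)
  have hproxG : ∀ x, prox τ G x = p x := fun x => prox_eq_of_hasSubgradient hτ (hp x)
  -- Moreau decomposition: the prox of the conjugate comes from the resolvent of `H` itself, so `H*`
  -- is never computed.
  have hproxH : ∀ x, prox σ (conjugate H) x = x - σ • q x := fun x =>
    prox_eq_of_hasSubgradient hσ (by
      rw [sub_sub_cancel, inv_smul_smul₀ hσ.ne']
      exact (hq x).conjugate)
  -- `T` is the unrelaxed step, with the proximity operators replaced by the continuous resolvents.
  let A : X × Y → X := fun z => p (z.1 - τ • gradient F z.1 - τ • ContinuousLinearMap.adjoint L z.2)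
  let D : X × Y → Y := fun z => z.2 + σ • L ((2 : ℝ) • A z - z.1)
  let T : X × Y → X × Y := fun z => (A z, D z - σ • q (D z))
  have hA : Continuous A := by fun_prop
  have hD : Continuous D := by fun_prop
  have hT : Continuous T := by fun_prop
  have hstep : ∀ r z, pdsStep F G H L τ σ r z = r • T z + (1 - r) • z := by
    intro r z
    simp only [pdsStep, hproxG, hproxH]
    rfl
  have hT1 : ∀ z, HasSubgradient G (τ⁻¹ • (z.1 - (T z).1) - gradient F z.1
      - ContinuousLinearMap.adjoint L z.2) (T z).1 := fun z => by
    have := hp (z.1 - τ • gradient F z.1 - τ • ContinuousLinearMap.adjoint L z.2)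
    convert this using 1
    rw [← inv_smul_smul₀ hτ.ne' (gradient F z.1),
      ← inv_smul_smul₀ hτ.ne' (ContinuousLinearMap.adjoint L z.2), ← smul_sub, ← smul_sub,
      inv_smul_smul₀ hτ.ne', inv_smul_smul₀ hτ.ne']
    congr 1
    simp only [T, A]
    abel
  have hT2 : ∀ z, HasSubgradient H (T z).2 (σ⁻¹ • (z.2 - (T z).2)
      + L ((2 : ℝ) • (T z).1 - z.1)) := fun z => by
    convert hq (D z) using 1
    rw [← inv_smul_smul₀ hσ.ne' (L _), ← smul_add, inv_smul_eq_iff₀ hσ.ne']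
    simp only [T, D]
    abel
  have hsad : ∀ z, T z = z ↔ IsSaddle (gradient F) G H L z := by
    intro z
    constructor
    · intro hz
      have h1 := hT1 z
      have h2 := hT2 z
      rw [hz, sub_self, smul_zero] at h1 h2
      refine ⟨by simpa using h1, ?_⟩
      convert h2 using 1
      rw [two_smul, add_sub_cancel_right, zero_add]
    · intro hz
      have e1 : p (z.1 - τ • gradient F z.1 - τ • ContinuousLinearMap.adjoint L z.2) = z.1 := by
        rw [← hproxG]
        refine prox_eq_of_hasSubgradient hτ ?_
        convert hz.1 using 1
        rw [inv_smul_eq_iff₀ hτ.ne', smul_sub, smul_neg]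
        abel
      have e2 : D z = z.2 + σ • L z.1 := by
        simp only [D, A, e1, two_smul, add_sub_cancel_right]
      have e3 : D z - σ • q (D z) = z.2 := by
        rw [← hproxH]
        refine prox_eq_of_hasSubgradient hσ ?_
        rw [e2, add_sub_cancel_left, inv_smul_smul₀ hσ.ne']
        exact hz.2.conjugate
      exact Prod.ext e1 e3
  obtain ⟨c, hc, hQc⟩ := exists_mul_norm_sq_le_metricSq hτ hσ hL hK
  obtain ⟨y, hy, hlim⟩ := exists_tendsto_fixedPoint_of_fejer (continuous_metricSq L τ σ)
    (by simp [metricSq]) hc hQc hT (z := pdsIter F G H L τ σ ρ z₀)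
    (fun k => mul_pos (hρ k).1 (sub_pos.2 (hρ k).2)) hsum
    (fun y hy k => by
      rw [pdsIter, hstep]
      exact ((hsad y).1 hy).metricSq_step_le hσ hβ hL hK hg (hT1 _) (hT2 _) (hρ k).1.le)
    (hs.imp fun s hs => (hsad s).2 hs)
  exact ⟨y, (hsad y).1 hy, hlim⟩

end PrimalDual

/-! ### The scalar Huber function. -/

section Huber

/-- The derivative of the Huber function of index `γ`: `t / γ` clipped to `[-1, 1]`. -/
def huberDeriv (γ t : ℝ) : ℝ := max (-1) (min 1 (t / γ))

/-- The Huber function of index `γ`. -/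
def huber (γ t : ℝ) : ℝ := huberDeriv γ t * t - γ / 2 * huberDeriv γ t ^ 2

theorem abs_huberDeriv_le (γ t : ℝ) : |huberDeriv γ t| ≤ 1 :=
  abs_le.2 ⟨le_max_left _ _, max_le (by norm_num) (min_le_left _ _)⟩

variable {γ : ℝ}

/-- `huberDeriv γ t` is the projection of `t / γ` onto `[-1, 1]`, and this is its variational
inequality. Equivalently it attains the maximum of `u t - γ u² / 2` over `|u| ≤ 1`, whose value is
the Huber function; the estimates below rest on this dual form. -/
theorem huberDeriv_optimal (hγ : 0 < γ) (t : ℝ) {u : ℝ} (hu : |u| ≤ 1) :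
    0 ≤ (t - γ * huberDeriv γ t) * (huberDeriv γ t - u) := by
  obtain ⟨h1, h2⟩ := abs_le.1 hu
  unfold huberDeriv
  rcases le_total (t / γ) 1 with h | h
  · rw [min_eq_right h]
    rcases le_total (t / γ) (-1) with h' | h'
    · rw [max_eq_left h']
      rw [div_le_iff₀ hγ] at h'
      exact mul_nonneg_of_nonpos_of_nonpos (by linarith) (by linarith)
    · rw [max_eq_right h', mul_div_cancel₀ _ hγ.ne', sub_self, zero_mul]
  · rw [min_eq_left h, max_eq_right (by norm_num)]
    rw [le_div_iff₀ hγ] at h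
    exact mul_nonneg (by linarith) (by linarith)

theorem huber_sub_nonneg (hγ : 0 < γ) (s t : ℝ) :
    0 ≤ huber γ s - huber γ t - huberDeriv γ t * (s - t) := by
  have h := huberDeriv_optimal hγ s (abs_huberDeriv_le γ t)
  have h' : 0 ≤ γ * (huberDeriv γ s - huberDeriv γ t) ^ 2 := by positivity
  unfold huber
  linarith

theorem huber_sub_le (hγ : 0 < γ) (s t : ℝ) :
    huber γ s - huber γ t - huberDeriv γ t * (s - t) ≤ γ⁻¹ / 2 * (s - t) ^ 2 := by
  have h := huberDeriv_optimal hγ t (abs_huberDeriv_le γ s)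
  have h' : 0 ≤ γ⁻¹ / 2 * ((s - t) - γ * (huberDeriv γ s - huberDeriv γ t)) ^ 2 := by positivity
  have e : γ⁻¹ / 2 * ((s - t) - γ * (huberDeriv γ s - huberDeriv γ t)) ^ 2 =
      γ⁻¹ / 2 * (s - t) ^ 2 - (s - t) * (huberDeriv γ s - huberDeriv γ t) +
      γ / 2 * (huberDeriv γ s - huberDeriv γ t) ^ 2 := by
    field_simp
    ring
  unfold huber
  linarith

theorem mul_huberDeriv_sub_sq_le (hγ : 0 < γ) (s t : ℝ) :
    γ * (huberDeriv γ s - huberDeriv γ t) ^ 2 ≤ (huberDeriv γ s - huberDeriv γ t) * (s - t) := by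
  have h := huberDeriv_optimal hγ t (abs_huberDeriv_le γ s)
  have h' := huberDeriv_optimal hγ s (abs_huberDeriv_le γ t)
  linarith

theorem huber_le (hγ : 0 < γ) (t y : ℝ) : huber γ t ≤ |y| + 1 / (2 * γ) * (t - y) ^ 2 := by
  have h1 : huberDeriv γ t * y ≤ |y| := by
    refine (le_abs_self _).trans ?_
    rw [abs_mul]
    exact mul_le_of_le_one_left (abs_nonneg _) (abs_huberDeriv_le γ t)
  have h2 : 0 ≤ 1 / (2 * γ) * (t - y - γ * huberDeriv γ t) ^ 2 := by positivity
  have e : 1 / (2 * γ) * (t - y - γ * huberDeriv γ t) ^ 2 = 1 / (2 * γ) * (t - y) ^ 2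
      - huberDeriv γ t * (t - y) + γ / 2 * huberDeriv γ t ^ 2 := by
    field_simp
    ring
  unfold huber
  linarith

/-- The envelope is attained at the soft threshold `t - γ * huberDeriv γ t`, whose sign agrees with
`huberDeriv γ t`. -/
theorem huber_eq (hγ : 0 < γ) (t : ℝ) : |t - γ * huberDeriv γ t| +
    1 / (2 * γ) * (t - (t - γ * huberDeriv γ t)) ^ 2 = huber γ t := by
  refine le_antisymm ?_ (huber_le hγ t _)
  have h1 := huberDeriv_optimal hγ t (u := 1) (by simp)
  have h2 := huberDeriv_optimal hγ t (u := -1) (by simp)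
  have h3 : |t - γ * huberDeriv γ t| ≤ huberDeriv γ t * (t - γ * huberDeriv γ t) :=
    abs_le.2 ⟨by linarith, by linarith⟩
  have e : 1 / (2 * γ) * (t - (t - γ * huberDeriv γ t)) ^ 2 = γ / 2 * huberDeriv γ t ^ 2 := by
    field_simp
    ring
  rw [e]
  unfold huber
  linarith

theorem huber_le_abs (hγ : 0 < γ) (t : ℝ) : huber γ t ≤ |t| := by
  simpa using huber_le hγ t t

end Huber

/-! ### Convexity and smoothness of `F`. -/

section SmoothPart

variable {n : ℕ} {lam₁ lam₂ γ : ℝ}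

theorem norm_sq_eq_sum (w : WeightSpace n) : ‖w‖ ^ 2 = ∑ e, w e ^ 2 := by
  simp [EuclideanSpace.norm_sq_eq]

theorem inner_eq_sum (w v : WeightSpace n) : inner ℝ w v = ∑ e, w e * v e := by
  simp [PiLp.inner_apply, mul_comm]

theorem moreauEnvelope_l1norm (hγ : 0 < γ) (w : WeightSpace n) :
    moreauEnvelope γ l1norm w = ∑ e, huber γ (w e) := by
  have hlow : ∀ y : WeightSpace n, ∑ e, huber γ (w e) ≤ l1norm y + 1 / (2 * γ) * ‖w - y‖ ^ 2 := by
    intro y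
    rw [norm_sq_eq_sum, l1norm, Finset.mul_sum, ← Finset.sum_add_distrib]
    exact Finset.sum_le_sum fun e _ => huber_le hγ _ _
  refine le_antisymm ?_ (le_ciInf hlow)
  refine (ciInf_le ⟨_, by rintro _ ⟨y, rfl⟩; exact hlow y⟩
    (WithLp.toLp 2 fun e => w e - γ * huberDeriv γ (w e))).trans (le_of_eq ?_)
  rw [norm_sq_eq_sum, l1norm, Finset.mul_sum, ← Finset.sum_add_distrib]
  exact Finset.sum_congr rfl fun e _ => huber_eq hγ _

theorem smoothPart_eq_sum (hγ : 0 < γ) (w : WeightSpace n) :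
    smoothPart n lam₁ lam₂ γ w = ∑ e, (lam₂ / 2 * w e ^ 2 - lam₁ * huber γ (w e)) := by
  rw [smoothPart, moreauEnvelope_l1norm hγ, norm_sq_eq_sum, Finset.sum_sub_distrib,
    ← Finset.mul_sum, ← Finset.mul_sum]
  ring

/-- The gradient of the smooth part. -/
def smoothGrad (n : ℕ) (lam₁ lam₂ γ : ℝ) (w : WeightSpace n) : WeightSpace n :=
  WithLp.toLp 2 fun e => lam₂ * w e - lam₁ * huberDeriv γ (w e)

theorem smoothPart_sub_eq_sum (hγ : 0 < γ) (w v : WeightSpace n) :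
    smoothPart n lam₁ lam₂ γ v - smoothPart n lam₁ lam₂ γ w -
      inner ℝ (smoothGrad n lam₁ lam₂ γ w) (v - w) =
    ∑ e, (lam₂ / 2 * (v e - w e) ^ 2 -
      lam₁ * (huber γ (v e) - huber γ (w e) - huberDeriv γ (w e) * (v e - w e))) := by
  rw [smoothPart_eq_sum hγ, smoothPart_eq_sum hγ, inner_eq_sum, ← Finset.sum_sub_distrib,
    ← Finset.sum_sub_distrib]
  refine Finset.sum_congr rfl fun e _ => ?_
  simp only [smoothGrad, PiLp.sub_apply]
  ring

/-- The Huber term enters with a minus sign, so its quadratic upper bound yields convexity here,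
while its convexity yields the upper bound in `smoothPart_sub_le`. -/
theorem smoothPart_sub_nonneg (hlam₁ : 0 ≤ lam₁) (hγ : 0 < γ) (hconv : γ⁻¹ * lam₁ ≤ lam₂)
    (w v : WeightSpace n) :
    smoothPart n lam₁ lam₂ γ w + inner ℝ (smoothGrad n lam₁ lam₂ γ w) (v - w) ≤
    smoothPart n lam₁ lam₂ γ v := by
  have : 0 ≤ ∑ e, (lam₂ / 2 * (v e - w e) ^ 2 -
      lam₁ * (huber γ (v e) - huber γ (w e) - huberDeriv γ (w e) * (v e - w e))) := by
    refine Finset.sum_nonneg fun e _ => ?_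
    have h1 := mul_le_mul_of_nonneg_left (huber_sub_le hγ (v e) (w e)) hlam₁
    have h2 := mul_le_mul_of_nonneg_right hconv (sq_nonneg (v e - w e))
    linarith
  rw [← smoothPart_sub_eq_sum hγ] at this
  linarith

theorem smoothPart_sub_le (hlam₁ : 0 ≤ lam₁) (hγ : 0 < γ) (w v : WeightSpace n) :
    smoothPart n lam₁ lam₂ γ v ≤
    smoothPart n lam₁ lam₂ γ w + inner ℝ (smoothGrad n lam₁ lam₂ γ w) (v - w) +
      lam₂ / 2 * ‖v - w‖ ^ 2 := by
  have : ∑ e, (lam₂ / 2 * (v e - w e) ^ 2 -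
      lam₁ * (huber γ (v e) - huber γ (w e) - huberDeriv γ (w e) * (v e - w e))) ≤
      lam₂ / 2 * ‖v - w‖ ^ 2 := by
    rw [norm_sq_eq_sum, Finset.mul_sum]
    refine Finset.sum_le_sum fun e _ => ?_
    have h1 := mul_nonneg hlam₁ (huber_sub_nonneg hγ (v e) (w e))
    simp only [PiLp.sub_apply]
    linarith
  rw [← smoothPart_sub_eq_sum hγ] at this
  linarith

theorem convexOn_smoothPart (hlam₁ : 0 ≤ lam₁) (hγ : 0 < γ) (hconv : γ⁻¹ * lam₁ ≤ lam₂) :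
    ConvexOn ℝ Set.univ (smoothPart n lam₁ lam₂ γ) := by
  refine ⟨convex_univ, fun x _ y _ a b ha hb hab => ?_⟩
  have h1 := smoothPart_sub_nonneg hlam₁ hγ hconv (a • x + b • y) x
  have h2 := smoothPart_sub_nonneg hlam₁ hγ hconv (a • x + b • y) y
  have e : a * inner ℝ (smoothGrad n lam₁ lam₂ γ (a • x + b • y)) (x - (a • x + b • y)) +
      b * inner ℝ (smoothGrad n lam₁ lam₂ γ (a • x + b • y)) (y - (a • x + b • y)) = 0 := by
    rw [← inner_smul_right, ← inner_smul_right, ← inner_add_right]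
    convert inner_zero_right _
    rw [smul_sub, smul_sub, sub_add_sub_comm, ← add_smul, hab, one_smul, sub_self]
  have h3 := mul_le_mul_of_nonneg_left h1 ha
  have h4 := mul_le_mul_of_nonneg_left h2 hb
  have h5 : a * smoothPart n lam₁ lam₂ γ (a • x + b • y) +
    b * smoothPart n lam₁ lam₂ γ (a • x + b • y) = smoothPart n lam₁ lam₂ γ (a • x + b • y) := by
    rw [← add_mul, hab, one_mul]
  simp only [smul_eq_mul]
  linarith

theorem hasGradientAt_smoothPart (hlam₁ : 0 ≤ lam₁) (hγ : 0 < γ) (hconv : γ⁻¹ * lam₁ ≤ lam₂)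
    (w : WeightSpace n) :
    HasGradientAt (smoothPart n lam₁ lam₂ γ) (smoothGrad n lam₁ lam₂ γ w) w := by
  rw [hasGradientAt_iff_isLittleO]
  -- The linearization error lies between 0 and `λ₂/2 ‖v - w‖²`.
  refine Asymptotics.IsBigO.trans_isLittleO (g := fun v => ‖v - w‖ ^ 2) ?_ ?_
  · refine Asymptotics.IsBigO.of_bound (lam₂ / 2) (Eventually.of_forall fun v => ?_)
    have h1 := smoothPart_sub_nonneg hlam₁ hγ hconv w v
    have h2 := smoothPart_sub_le (lam₂ := lam₂) hlam₁ hγ w v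
    rw [Real.norm_of_nonneg (by linarith), Real.norm_of_nonneg (by positivity)]
    linarith
  · have : Tendsto (fun v : WeightSpace n => v - w) (𝓝 w) (𝓝 0) := by
      have : Continuous fun v : WeightSpace n => v - w := by fun_prop
      simpa using this.tendsto w
    exact (Asymptotics.isLittleO_norm_pow_id one_lt_two).comp_tendsto this

theorem gradient_smoothPart (hlam₁ : 0 ≤ lam₁) (hγ : 0 < γ) (hconv : γ⁻¹ * lam₁ ≤ lam₂) :
    gradient (smoothPart n lam₁ lam₂ γ) = smoothGrad n lam₁ lam₂ γ :=
  gradient_eq fun w => hasGradientAt_smoothPart hlam₁ hγ hconv w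

/-- Coordinatewise, with `a` and `h` the differences of the arguments and of the Huber derivatives,
the claim reduces to `λ₁² h² ≤ λ₁ λ₂ h a`, which follows from `γ h² ≤ h a` and `λ₁ ≤ λ₂ γ`. -/
theorem smoothGrad_cocoercive (hlam₁ : 0 ≤ lam₁) (hlam₂ : 0 ≤ lam₂) (hγ : 0 < γ)
    (hconv : γ⁻¹ * lam₁ ≤ lam₂) (w v : WeightSpace n) :
    ‖smoothGrad n lam₁ lam₂ γ w - smoothGrad n lam₁ lam₂ γ v‖ ^ 2 ≤
      lam₂ * inner ℝ (smoothGrad n lam₁ lam₂ γ w - smoothGrad n lam₁ lam₂ γ v) (w - v) := by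
  rw [norm_sq_eq_sum, inner_eq_sum, Finset.mul_sum]
  refine Finset.sum_le_sum fun e _ => ?_
  simp only [smoothGrad, PiLp.sub_apply]
  have h1 := mul_le_mul_of_nonneg_left (mul_huberDeriv_sub_sq_le hγ (w e) (v e)) hlam₂
  have h2 : lam₁ ≤ lam₂ * γ := by rwa [inv_mul_eq_div, div_le_iff₀ hγ] at hconv
  have h3 := mul_le_mul_of_nonneg_right h2 (sq_nonneg (huberDeriv γ (w e) - huberDeriv γ (v e)))
  have h4 := mul_nonneg hlam₁ (sub_nonneg.2 (h3.trans (le_of_eq_of_le (by ring) h1)))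
  linarith

theorem lipschitzWith_smoothGrad (hlam₁ : 0 ≤ lam₁) (hlam₂ : 0 ≤ lam₂) (hγ : 0 < γ)
    (hconv : γ⁻¹ * lam₁ ≤ lam₂) : LipschitzWith lam₂.toNNReal (smoothGrad n lam₁ lam₂ γ) := by
  refine LipschitzWith.of_dist_le_mul fun w v => ?_
  rw [Real.coe_toNNReal _ hlam₂, dist_eq_norm, dist_eq_norm]
  have h1 := smoothGrad_cocoercive hlam₁ hlam₂ hγ hconv w v
  have h2 := mul_le_mul_of_nonneg_left (real_inner_le_norm
    (smoothGrad n lam₁ lam₂ γ w - smoothGrad n lam₁ lam₂ γ v) (w - v)) hlam₂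
  rcases (norm_nonneg (smoothGrad n lam₁ lam₂ γ w - smoothGrad n lam₁ lam₂ γ v)).eq_or_lt
    with h | h
  · rw [← h]; positivity
  · refine le_of_mul_le_mul_left ?_ h
    linarith

end SmoothPart

/-! ### The operator norm of the Laplacian. -/

section LaplacianNorm

variable {n : ℕ}

theorem weightMatrix_apply_of_lt (w : WeightSpace n) {i j : Fin n} (h : i < j) :
    weightMatrix w i j = w ⟨(i, j), h⟩ := by
  simp [weightMatrix, h]

theorem weightMatrix_symm (w : WeightSpace n) (i j : Fin n) :
    weightMatrix w i j = weightMatrix w j i := by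
  rcases lt_trichotomy i j with h | h | h
  · simp [weightMatrix, h, h.not_gt]
  · rw [h]
  · simp [weightMatrix, h, h.not_gt]

@[simp]
theorem weightMatrix_self (w : WeightSpace n) (i : Fin n) : weightMatrix w i i = 0 := by
  simp [weightMatrix]

theorem sum_edgeIdx (f : Fin n → Fin n → ℝ) :
    ∑ e : EdgeIdx n, f e.1.1 e.1.2 = ∑ i, ∑ j, if i < j then f i j else 0 := by
  rw [← Finset.sum_product', Finset.univ_product_univ, ← Finset.sum_filter]
  exact (Finset.sum_subtype (Finset.univ.filter fun p : Fin n × Fin n => p.1 < p.2) (by simp)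
    fun p => f p.1 p.2).symm

theorem sum_weightMatrix_sq (w : WeightSpace n) :
    ∑ i, ∑ j, weightMatrix w i j ^ 2 = 2 * ‖w‖ ^ 2 := by
  have h1 : ‖w‖ ^ 2 = ∑ i, ∑ j, if i < j then weightMatrix w i j ^ 2 else 0 := by
    rw [norm_sq_eq_sum, ← sum_edgeIdx fun i j => weightMatrix w i j ^ 2]
    exact Finset.sum_congr rfl fun e _ => by rw [weightMatrix_apply_of_lt w e.2]
  have h2 : ∑ i, ∑ j, (if i < j then weightMatrix w i j ^ 2 else 0) =
      ∑ i, ∑ j, if j < i then weightMatrix w i j ^ 2 else 0 := by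
    rw [Finset.sum_comm]
    exact Finset.sum_congr rfl fun i _ => Finset.sum_congr rfl fun j _ => by
      rw [weightMatrix_symm]
  have h3 : ∑ i, ∑ j, weightMatrix w i j ^ 2 =
      ∑ i, ∑ j, (if i < j then weightMatrix w i j ^ 2 else 0) +
      ∑ i, ∑ j, (if j < i then weightMatrix w i j ^ 2 else 0) := by
    simp only [← Finset.sum_add_distrib]
    refine Finset.sum_congr rfl fun i _ => Finset.sum_congr rfl fun j _ => ?_
    rcases lt_trichotomy i j with h | h | h
    · simp [h, h.not_gt]
    · simp [h]
    · simp [h, h.not_gt]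
  rw [h3, ← h2, ← h1, two_mul]

/-- The degrees sit on the diagonal and the weights off it, so their squares do not mix. -/
theorem norm_laplacianOp_sq (w : WeightSpace n) :
    ‖laplacianOp n w‖ ^ 2 = ∑ i, (∑ j, weightMatrix w i j) ^ 2 + 2 * ‖w‖ ^ 2 := by
  have h : ‖laplacianOp n w‖ ^ 2 = ∑ i, ∑ j, laplacian w i j ^ 2 := by
    rw [EuclideanSpace.norm_sq_eq, Fintype.sum_prod_type]
    simp [laplacianOp]
  rw [h, ← sum_weightMatrix_sq, ← Finset.sum_add_distrib]
  refine Finset.sum_congr rfl fun i _ => ?_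
  have : ∀ j, laplacian w i j ^ 2 =
      (if i = j then (∑ j, weightMatrix w i j) ^ 2 else 0) + weightMatrix w i j ^ 2 := by
    intro j
    by_cases hij : i = j
    · subst hij; simp [laplacian]
    · simp [laplacian, hij]
  simp [this, Finset.sum_add_distrib]

theorem norm_laplacianOp_sq_le (w : WeightSpace n) :
    ‖laplacianOp n w‖ ^ 2 ≤ 2 * n * ‖w‖ ^ 2 := by
  rw [norm_laplacianOp_sq]
  have h : ∀ i, (∑ j, weightMatrix w i j) ^ 2 ≤ (n - 1) * ∑ j, weightMatrix w i j ^ 2 := by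
    intro i
    -- Dropping the zero diagonal entry lets Cauchy–Schwarz run over `n - 1` terms. The exponent `k
    -- + 1` covers both the sum and the sum of squares.
    have h1 : ∀ k : ℕ, ∑ j, weightMatrix w i j ^ (k + 1) =
        ∑ j ∈ Finset.univ.erase i, weightMatrix w i j ^ (k + 1) := fun k => by
      rw [← Finset.add_sum_erase _ _ (Finset.mem_univ i)]
      simp
    have h2 := sq_sum_le_card_mul_sum_sq (s := Finset.univ.erase i) (f := weightMatrix w i)
    rw [Finset.card_erase_of_mem (Finset.mem_univ i), Finset.card_univ, Fintype.card_fin,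
      Nat.cast_sub (by have := i.2; omega), Nat.cast_one] at h2
    have h3 := h1 0
    simp only [zero_add, pow_one] at h3
    rw [h3, h1 1]
    exact h2
  calc _ ≤ ∑ i, (n - 1 : ℝ) * ∑ j, weightMatrix w i j ^ 2 + 2 * ‖w‖ ^ 2 := by
        gcongr with i; exact h i
    _ = _ := by rw [← Finset.mul_sum, sum_weightMatrix_sq]; ring

theorem sum_weightMatrix_const (c : ℝ) (i : Fin n) :
    ∑ j, weightMatrix (WithLp.toLp 2 fun _ => c : WeightSpace n) i j = (n - 1) * c := by
  have : ∀ j, weightMatrix (WithLp.toLp 2 fun _ => c : WeightSpace n) i j =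
      c - if i = j then c else 0 := by
    intro j
    rcases lt_trichotomy i j with h | h | h
    · simp [weightMatrix, h, h.ne]
    · simp [weightMatrix, h]
    · simp [weightMatrix, h, h.ne', h.not_gt]
  simp [this, Finset.sum_sub_distrib]
  ring

/-- Unlike the equality, this holds for every `n`, and it is all that convergence needs. -/
theorem norm_laplacianOp_sq_le_two_mul : ‖laplacianOp n‖ ^ 2 ≤ 2 * (n : ℝ) := by
  have : ‖laplacianOp n‖ ≤ Real.sqrt (2 * n) := by
    refine ContinuousLinearMap.opNorm_le_bound _ (Real.sqrt_nonneg _) fun w => ?_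
    rw [← Real.sqrt_sq (norm_nonneg w), ← Real.sqrt_mul (by positivity)]
    exact Real.le_sqrt_of_sq_le (norm_laplacianOp_sq_le w)
  calc _ ≤ Real.sqrt (2 * n) ^ 2 := by gcongr
    _ = _ := Real.sq_sqrt (by positivity)

theorem norm_laplacianOp_sq_eq (hn : 2 ≤ n) : ‖laplacianOp n‖ ^ 2 = 2 * (n : ℝ) := by
  refine le_antisymm norm_laplacianOp_sq_le_two_mul ?_
  -- The complete graph: all off-diagonal weights in a row agree, so Cauchy–Schwarz is an equality.
  set w : WeightSpace n := WithLp.toLp 2 fun _ => (1 : ℝ)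
  have h1 : 2 * ‖w‖ ^ 2 = n * (n - 1) := by
    have hw : ∀ i j, weightMatrix w i j ^ 2 = weightMatrix w i j := by
      intro i j
      simp only [weightMatrix, Matrix.of_apply]
      split_ifs <;> simp [w]
    rw [← sum_weightMatrix_sq]
    simp only [hw, w, sum_weightMatrix_const]
    simp [mul_sub]
  have h2 : ‖laplacianOp n w‖ ^ 2 = 2 * n * ‖w‖ ^ 2 := by
    rw [norm_laplacianOp_sq]
    simp only [w, sum_weightMatrix_const]
    simp only [mul_one, Finset.sum_const, Finset.card_univ, Fintype.card_fin, nsmul_eq_mul]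
    change _ + 2 * ‖w‖ ^ 2 = 2 * n * ‖w‖ ^ 2
    linear_combination (1 - n : ℝ) * h1
  have hn' : (2 : ℝ) ≤ n := by exact_mod_cast hn
  have h3 : 0 < ‖w‖ ^ 2 := by nlinarith
  refine le_of_mul_le_mul_right ?_ h3
  rw [← h2, ← mul_pow]
  gcongr
  exact (laplacianOp n).le_opNorm w

end LaplacianNorm

/-! ### Log-determinant inequalities and a matrix quadratic equation. -/

section LogDet

open Matrix

variable {m : Type*} [Fintype m] [DecidableEq m]

/-- Apply `x ≤ exp (x - 1)` to each eigenvalue. -/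
theorem det_le_exp_trace {B : Matrix m m ℝ} (hB : B.PosSemidef) :
    B.det ≤ Real.exp (B.trace - Fintype.card m) := by
  have h : B.trace - Fintype.card m = ∑ i, (hB.1.eigenvalues i - 1) := by
    rw [hB.1.trace_eq_sum_eigenvalues, Finset.sum_sub_distrib]
    simp
  rw [h, Real.exp_sum, hB.1.det_eq_prod_eigenvalues]
  refine Finset.prod_le_prod (fun i _ => by simpa using hB.eigenvalues_nonneg i) fun i _ => ?_
  simpa using Real.add_one_le_exp (hB.1.eigenvalues i - 1)

/-- The tangent inequality for the concave function `log det`. With `A⁻¹ = Cᴴ C`, the symmetric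
matrix `C B Cᴴ` stands in for `A⁻¹ B`, sharing its determinant and trace. -/
theorem log_det_le {A B : Matrix m m ℝ} (hA : A.PosDef) (hB : B.PosDef) :
    Real.log B.det ≤ Real.log A.det + ((A⁻¹ * B).trace - Fintype.card m) := by
  obtain ⟨C, hC⟩ : ∃ C : Matrix m m ℝ, A⁻¹ = Cᴴ * C := by
    open scoped MatrixOrder in
    exact CStarAlgebra.nonneg_iff_eq_star_mul_self.1 hA.inv.posSemidef.nonneg
  have hP : (C * B * Cᴴ).PosSemidef := hB.posSemidef.mul_mul_conjTranspose_same C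
  have hdet : (C * B * Cᴴ).det = A.det⁻¹ * B.det := by
    have : A.det⁻¹ = Cᴴ.det * C.det := by
      rw [← det_mul, ← hC, det_nonsing_inv, Ring.inverse_eq_inv']
    rw [this, det_mul, det_mul]
    ring
  have htr : (C * B * Cᴴ).trace = (A⁻¹ * B).trace := by
    rw [hC, trace_mul_comm, ← mul_assoc]
  have h := det_le_exp_trace hP
  rw [hdet, htr] at h
  have h1 := Real.log_le_log (mul_pos (inv_pos.2 hA.det_pos) hB.det_pos) h
  rw [Real.log_exp, Real.log_mul (inv_pos.2 hA.det_pos).ne' hB.det_pos.ne', Real.log_inv] at h1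
  linarith

theorem exists_posDef_smul_sub_inv_eq {M : Matrix m m ℝ} (hM : M.IsHermitian) {σ : ℝ}
    (hσ : 0 < σ) : ∃ Z : Matrix m m ℝ, Z.PosDef ∧ σ • Z - Z⁻¹ = M := by
  set U := hM.eigenvectorUnitary
  set d := hM.eigenvalues
  have hspec : M = (U : Matrix m m ℝ) * diagonal d * star (U : Matrix m m ℝ) := by
    have := hM.spectral_theorem
    rw [Unitary.conjStarAlgAut_apply] at this
    simpa using this
  -- On each eigenvalue the equation is `σ y - 1/y = d`; this is the positive root of `σ y² - d y -
  -- 1`.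
  let y : m → ℝ := fun i => (d i + Real.sqrt (d i ^ 2 + 4 * σ)) / (2 * σ)
  have hsq : ∀ i, Real.sqrt (d i ^ 2 + 4 * σ) ^ 2 = d i ^ 2 + 4 * σ := fun i =>
    Real.sq_sqrt (by positivity)
  have hy : ∀ i, 0 < y i := by
    intro i
    have : -d i < Real.sqrt (d i ^ 2 + 4 * σ) := Real.lt_sqrt_of_sq_lt (by linarith)
    exact div_pos (by linarith) (by linarith)
  have hyd : ∀ i, σ * y i - (y i)⁻¹ = d i := by
    intro i
    have h1 : σ * y i ^ 2 - d i * y i - 1 = 0 := by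
      simp only [y]
      field_simp
      rw [mul_comm σ 4]
      linear_combination hsq i
    have := hy i
    field_simp
    linarith
  have hU : star (U : Matrix m m ℝ) * U = 1 := Unitary.coe_star_mul_self U
  have hU' : (U : Matrix m m ℝ) * star (U : Matrix m m ℝ) = 1 := Unitary.coe_mul_star_self U
  have hinv : ((U : Matrix m m ℝ) * diagonal y * star (U : Matrix m m ℝ))⁻¹ =
      (U : Matrix m m ℝ) * diagonal (fun i => (y i)⁻¹) * star (U : Matrix m m ℝ) := by
    refine inv_eq_right_inv ?_
    calc _ = (U : Matrix m m ℝ) * diagonal y * (star (U : Matrix m m ℝ) * U) *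
          diagonal (fun i => (y i)⁻¹) * star (U : Matrix m m ℝ) := by
          simp only [mul_assoc]
      _ = 1 := by
          rw [hU, mul_one, mul_assoc (U : Matrix m m ℝ), diagonal_mul_diagonal]
          have : (fun i => y i * (y i)⁻¹) = fun _ => 1 := by
            funext i; exact mul_inv_cancel₀ (hy i).ne'
          rw [this, diagonal_one, mul_one, hU']
  refine ⟨(U : Matrix m m ℝ) * diagonal y * star (U : Matrix m m ℝ), ?_, ?_⟩
  · exact (IsUnit.posDef_star_right_conjugate_iff Unitary.isUnit_coe).2
      (posDef_diagonal_iff.2 hy)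
  · rw [hinv, hspec, ← smul_mul_assoc, ← mul_smul_comm, ← sub_mul, ← mul_sub, ← diagonal_smul,
      diagonal_sub]
    congr 3
    funext i
    simpa using hyd i

end LogDet

/-! ### Positivity of the Laplacian, and subgradients and resolvent of `H`. -/

section Laplacian

open Matrix

variable {n : ℕ}

theorem inner_matSpace_eq_sum (u v : MatSpace n) :
    inner ℝ u v = ∑ i, ∑ j, toMat u i j * toMat v i j := by
  simp [PiLp.inner_apply, Fintype.sum_prod_type, toMat, mul_comm]

theorem inner_matSpace_eq_trace (u v : MatSpace n) :
    inner ℝ u v = ((toMat u)ᵀ * toMat v).trace := by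
  rw [inner_matSpace_eq_sum, Finset.sum_comm]
  simp [trace, mul_apply]

@[simp]
theorem toMat_laplacianOp (w : WeightSpace n) : toMat (laplacianOp n w) = laplacian w := rfl

@[simp]
theorem toMat_sub (u v : MatSpace n) : toMat (u - v) = toMat u - toMat v := rfl

@[simp]
theorem toMat_smul (c : ℝ) (v : MatSpace n) : toMat (c • v) = c • toMat v := rfl

/-- A matrix viewed as an element of `MatSpace n`. -/
def ofMat (A : Matrix (Fin n) (Fin n) ℝ) : MatSpace n := WithLp.toLp 2 fun p => A p.1 p.2

@[simp]
theorem toMat_ofMat (A : Matrix (Fin n) (Fin n) ℝ) : toMat (ofMat A) = A := rfl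

theorem laplacian_transpose (w : WeightSpace n) : (laplacian w)ᵀ = laplacian w := by
  ext i j
  rw [transpose_apply]
  simp only [laplacian, Matrix.sub_apply, weightMatrix_symm w j i]
  by_cases h : i = j
  · rw [h]
  · rw [diagonal_apply_ne _ h, diagonal_apply_ne _ (Ne.symm h)]

/-- The quadratic form is half the sum of `w_ij (x_i - x_j)²` over all ordered pairs. -/
theorem posSemidef_laplacian {w : WeightSpace n} (hw : ∀ e, 0 ≤ w e) :
    (laplacian w).PosSemidef := by
  refine PosSemidef.of_dotProduct_mulVec_nonneg ?_ fun x => ?_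
  · rw [IsHermitian, conjTranspose_eq_transpose_of_trivial, laplacian_transpose]
  · have h1 : 0 ≤ ∑ i, ∑ j, weightMatrix w i j * (x i - x j) ^ 2 :=
      Finset.sum_nonneg fun i _ => Finset.sum_nonneg fun j _ => mul_nonneg (by
        simp only [weightMatrix, of_apply]
        split_ifs <;> simp [hw]) (sq_nonneg _)
    have h2 : star x ⬝ᵥ laplacian w *ᵥ x =
        ∑ i, ∑ j, (weightMatrix w i j * x i ^ 2 - weightMatrix w i j * x i * x j) := by
      simp only [laplacian, sub_mulVec, dotProduct, Pi.star_apply, star_trivial, Pi.sub_apply,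
        mulVec_diagonal]
      refine Finset.sum_congr rfl fun i _ => ?_
      rw [mul_sub, Finset.sum_sub_distrib, ← Finset.sum_mul, mulVec, dotProduct, Finset.mul_sum]
      congr 1
      · ring
      · exact Finset.sum_congr rfl fun j _ => by ring
    have h3 : ∑ i, ∑ j, (weightMatrix w i j * x i ^ 2 - weightMatrix w i j * x i * x j) =
        ∑ i, ∑ j, (weightMatrix w i j * x j ^ 2 - weightMatrix w i j * x i * x j) := by
      rw [Finset.sum_comm]
      refine Finset.sum_congr rfl fun i _ => Finset.sum_congr rfl fun j _ => ?_
      rw [weightMatrix_symm]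
      ring
    have h4 : ∑ i, ∑ j, weightMatrix w i j * (x i - x j) ^ 2 =
        ∑ i, ∑ j, (weightMatrix w i j * x i ^ 2 - weightMatrix w i j * x i * x j) +
        ∑ i, ∑ j, (weightMatrix w i j * x j ^ 2 - weightMatrix w i j * x i * x j) := by
      simp only [← Finset.sum_add_distrib]
      exact Finset.sum_congr rfl fun i _ => Finset.sum_congr rfl fun j _ => by ring
    rw [h2]
    linarith

theorem posSemidef_avgMatrix : (avgMatrix n).PosSemidef := by
  have : avgMatrix n = (1 / (n : ℝ)) • vecMulVec (fun _ => 1) (star fun _ => 1) := by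
    ext i j
    simp [avgMatrix, vecMulVec]
  rw [this]
  exact (posSemidef_vecMulVec_self_star _).smul (by positivity)

/-- The edge weights `1/n`, for which `L w + J` is the identity. -/
def uniformWeight (n : ℕ) : WeightSpace n := WithLp.toLp 2 fun _ => 1 / (n : ℝ)

theorem laplacian_uniformWeight : laplacian (uniformWeight n) + avgMatrix n = 1 := by
  ext i j
  have hn : (n : ℝ) ≠ 0 := by
    have := i.2
    exact_mod_cast (show n ≠ 0 by omega)
  rcases lt_trichotomy i j with h | h | h
  · simp [laplacian, avgMatrix, h.ne, weightMatrix, h, uniformWeight]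
  · subst h
    simp only [laplacian, avgMatrix, Matrix.add_apply, Matrix.sub_apply, diagonal_apply_eq, of_apply,
      weightMatrix_self, one_apply_eq, uniformWeight, sum_weightMatrix_const]
    field_simp
    ring
  · simp [laplacian, avgMatrix, h.ne', weightMatrix, h, h.not_gt, uniformWeight]

/-- `H` is finite only at symmetric matrices, so only the symmetric part of `u` is constrained. This
is what admits an arbitrary, possibly non-symmetric, `V₀`. -/
theorem hasSubgradient_negLogDet {u q : MatSpace n} (hq : (toMat q + avgMatrix n).PosDef)
    (hu : toMat u + (toMat u)ᵀ = -(2 : ℝ) • (toMat q + avgMatrix n)⁻¹) :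
    HasSubgradient negLogDet u q := by
  refine ⟨-Real.log (toMat q + avgMatrix n).det, by rw [negLogDet, if_pos hq], fun y => ?_⟩
  by_cases hy : (toMat y + avgMatrix n).PosDef
  · rw [negLogDet, if_pos hy, EReal.coe_le_coe_iff]
    set A := toMat q + avgMatrix n with hA
    set B := toMat y + avgMatrix n with hB
    have hD : toMat (y - q) = B - A := by rw [toMat_sub, hA, hB]; abel
    have hDt : (B - A)ᵀ = B - A := by
      have h1 := hy.isHermitian
      have h2 := hq.isHermitian
      rw [IsHermitian, conjTranspose_eq_transpose_of_trivial] at h1 h2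
      rw [transpose_sub, h1, h2]
    have h1 : (toMat u * (B - A)).trace = ((toMat u)ᵀ * (B - A)).trace := by
      rw [← trace_transpose, transpose_mul, hDt, trace_mul_comm]
    have h2 : 2 * ((toMat u)ᵀ * (B - A)).trace = -2 * ((A⁻¹ * B).trace - n) := by
      have hAA : A⁻¹ * A = 1 := nonsing_inv_mul A hq.det_pos.ne'.isUnit
      calc _ = ((toMat u + (toMat u)ᵀ) * (B - A)).trace := by
            rw [add_mul, trace_add, h1, two_mul]
        _ = _ := by
            rw [hu, smul_mul_assoc, trace_smul, mul_sub, hAA, trace_sub, trace_one,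
              Fintype.card_fin, smul_eq_mul]
    have h3 := log_det_le hq hy
    rw [Fintype.card_fin] at h3
    rw [inner_matSpace_eq_trace, hD]
    linarith
  · rw [negLogDet, if_neg hy]
    exact le_top

theorem exists_resolvent_negLogDet {σ : ℝ} (hσ : 0 < σ) (x : MatSpace n) :
    ∃ q, HasSubgradient negLogDet (x - σ • q) q := by
  have hJ := (posSemidef_avgMatrix (n := n)).isHermitian
  rw [IsHermitian, conjTranspose_eq_transpose_of_trivial] at hJ
  -- Symmetrizing `x - σ • q` with `q = Z - J` turns the subgradient condition into `σ Z - Z⁻¹ = M`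
  -- for this matrix `M`.
  have hM : ((1 / 2 : ℝ) • (toMat x + (toMat x)ᵀ) + σ • avgMatrix n).IsHermitian := by
    rw [IsHermitian, conjTranspose_eq_transpose_of_trivial]
    simp only [transpose_add, transpose_smul, transpose_transpose, hJ]
    rw [add_comm (toMat x)ᵀ]
  obtain ⟨Z, hZ, hZM⟩ := exists_posDef_smul_sub_inv_eq hM hσ
  have hZt := hZ.isHermitian
  rw [IsHermitian, conjTranspose_eq_transpose_of_trivial] at hZt
  refine ⟨ofMat (Z - avgMatrix n), hasSubgradient_negLogDet (by simpa using hZ) ?_⟩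
  simp only [toMat_sub, toMat_smul, toMat_ofMat, sub_add_cancel, transpose_sub, transpose_smul,
    hZt, hJ]
  have : Z⁻¹ = σ • Z - ((1 / 2 : ℝ) • (toMat x + (toMat x)ᵀ) + σ • avgMatrix n) := by
    rw [← hZM]; abel
  rw [this]
  module

end Laplacian

/-! ### `G` as a linear function on the cone, and its resolvent. -/

section NonsmoothPart

variable {n : ℕ} (S : Matrix (Fin n) (Fin n) ℝ) (lam₁ : ℝ)

/-- The vector that represents the linear function which `nonsmoothPart` is on the cone. -/
def linearCoeff : WeightSpace n :=
  (WithLp.toLp 2 fun _ => lam₁) + ContinuousLinearMap.adjoint (laplacianOp n) (ofMat S)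

variable {S lam₁}

theorem inner_linearCoeff (w : WeightSpace n) : inner ℝ (linearCoeff S lam₁) w =
    lam₁ * ∑ e, w e + ∑ i, ∑ j, S i j * laplacian w i j := by
  rw [linearCoeff, inner_add_left, ContinuousLinearMap.adjoint_inner_left, inner_eq_sum,
    inner_matSpace_eq_sum, Finset.mul_sum]
  simp

theorem nonsmoothPart_of_nonneg {w : WeightSpace n} (hw : ∀ e, 0 ≤ w e) :
    nonsmoothPart S lam₁ w = (inner ℝ (linearCoeff S lam₁) w : ℝ) := by
  rw [nonsmoothPart, indicatorCone, if_pos hw, zero_add, inner_linearCoeff, l1norm]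
  simp only [abs_of_nonneg (hw _)]

theorem nonsmoothPart_of_not_nonneg {w : WeightSpace n} (hw : ¬ ∀ e, 0 ≤ w e) :
    nonsmoothPart S lam₁ w = ⊤ := by
  rw [nonsmoothPart, indicatorCone, if_neg hw, EReal.top_add_coe]

theorem hasSubgradient_nonsmoothPart {u w : WeightSpace n} (hw : ∀ e, 0 ≤ w e)
    (h : ∀ y : WeightSpace n, (∀ e, 0 ≤ y e) →
      inner ℝ u (y - w) ≤ (inner ℝ (linearCoeff S lam₁) (y - w) : ℝ)) :
    HasSubgradient (nonsmoothPart S lam₁) u w := by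
  refine ⟨_, nonsmoothPart_of_nonneg hw, fun y => ?_⟩
  by_cases hy : ∀ e, 0 ≤ y e
  · rw [nonsmoothPart_of_nonneg hy, EReal.coe_le_coe_iff]
    have := h y hy
    rw [inner_sub_right (linearCoeff S lam₁)] at this
    linarith
  · rw [nonsmoothPart_of_not_nonneg hy]
    exact le_top

theorem exists_resolvent_nonsmoothPart {τ : ℝ} (hτ : 0 < τ) (x : WeightSpace n) :
    ∃ p, HasSubgradient (nonsmoothPart S lam₁) (τ⁻¹ • (x - p)) p := by
  -- Shift by the linear coefficient, then project onto the cone.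
  refine ⟨WithLp.toLp 2 fun e => max (x e - τ * linearCoeff S lam₁ e) 0,
    hasSubgradient_nonsmoothPart (fun e => le_max_right _ _) fun y hy => ?_⟩
  rw [inner_eq_sum, inner_eq_sum]
  refine Finset.sum_le_sum fun e _ => ?_
  simp only [PiLp.smul_apply, PiLp.sub_apply, smul_eq_mul]
  have hy := hy e
  rw [mul_assoc, inv_mul_le_iff₀ hτ]
  rcases le_total (x e - τ * linearCoeff S lam₁ e) 0 with h | h
  · rw [max_eq_right h]
    nlinarith
  · rw [max_eq_left h]
    linarith

end NonsmoothPart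

/-! ### Minimizers versus saddle points, and existence of a minimizer. -/

section Minimizers

open Matrix

variable {n : ℕ} {S : Matrix (Fin n) (Fin n) ℝ} {lam₁ lam₂ γ : ℝ}

theorem cost_of_feasible {w : WeightSpace n} (hw : ∀ e, 0 ≤ w e)
    (hA : (laplacian w + avgMatrix n).PosDef) : cost S lam₁ lam₂ γ w =
    ((smoothPart n lam₁ lam₂ γ w + inner ℝ (linearCoeff S lam₁) w -
      Real.log (laplacian w + avgMatrix n).det : ℝ) : EReal) := by
  rw [cost, nonsmoothPart_of_nonneg hw, negLogDet, toMat_laplacianOp, if_pos hA,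
    ← EReal.coe_add, ← EReal.coe_add, sub_eq_add_neg]

theorem cost_of_not_feasible {w : WeightSpace n}
    (h : ¬ ((∀ e, 0 ≤ w e) ∧ (laplacian w + avgMatrix n).PosDef)) :
    cost S lam₁ lam₂ γ w = ⊤ := by
  by_cases hw : ∀ e, 0 ≤ w e
  · rw [cost, nonsmoothPart_of_nonneg hw, negLogDet, toMat_laplacianOp,
      if_neg fun hA => h ⟨hw, hA⟩, ← EReal.coe_add, EReal.coe_add_top]
  · rw [cost, nonsmoothPart_of_not_nonneg hw, EReal.coe_add_top, negLogDet]
    split_ifs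
    · exact EReal.top_add_coe _
    · rfl

theorem uniformWeight_nonneg (e : EdgeIdx n) : 0 ≤ uniformWeight n e := by
  simp [uniformWeight]

theorem IsGlobalMinimizer.feasible {w : WeightSpace n}
    (hw : IsGlobalMinimizer S lam₁ lam₂ γ w) :
    (∀ e, 0 ≤ w e) ∧ (laplacian w + avgMatrix n).PosDef := by
  by_contra h
  have h1 := hw (uniformWeight n)
  rw [cost_of_not_feasible h, cost_of_feasible uniformWeight_nonneg
    (by rw [laplacian_uniformWeight]; exact PosDef.one)] at h1
  exact EReal.coe_ne_top _ (top_le_iff.1 h1)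

theorem continuous_laplacian : Continuous fun w : WeightSpace n => laplacian w := by
  refine continuous_matrix fun i j => ?_
  exact (EuclideanSpace.proj (𝕜 := ℝ) (i, j)).continuous.comp (laplacianOp n).continuous

theorem inner_ofMat_laplacianOp (B : Matrix (Fin n) (Fin n) ℝ) (w : WeightSpace n) :
    inner ℝ (ofMat B) (laplacianOp n w) = (B * laplacian w).trace := by
  rw [inner_matSpace_eq_trace, toMat_ofMat, toMat_laplacianOp, ← trace_transpose, transpose_mul,
    transpose_transpose, laplacian_transpose, trace_mul_comm]

theorem laplacian_add_smul (w d : WeightSpace n) (t : ℝ) :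
    laplacian (w + t • d) = laplacian w + t • laplacian d := by
  have := congrArg toMat ((laplacianOp n).map_add w (t • d))
  rw [map_smul] at this
  exact this

/-- The first order optimality condition of the graph learning problem. -/
theorem IsGlobalMinimizer.trace_inv_mul_laplacian_le {w : WeightSpace n}
    (hw : IsGlobalMinimizer S lam₁ lam₂ γ w) (hlam₁ : 0 ≤ lam₁) (hγ : 0 < γ)
    {y : WeightSpace n} (hy : ∀ e, 0 ≤ y e) :
    ((laplacian w + avgMatrix n)⁻¹ * laplacian (y - w)).trace ≤
      inner ℝ (smoothGrad n lam₁ lam₂ γ w) (y - w) +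
      inner ℝ (linearCoeff S lam₁) (y - w) := by
  obtain ⟨hw0, hA⟩ := hw.feasible
  set d := y - w with hd
  let A : ℝ → Matrix (Fin n) (Fin n) ℝ := fun t => laplacian (w + t • d) + avgMatrix n
  have hAt : ∀ t, A t = laplacian w + avgMatrix n + t • laplacian d := fun t => by
    simp only [A, laplacian_add_smul]
    abel
  have hcomb : ∀ t : ℝ, w + t • d = (1 - t) • w + t • y := fun t => by rw [hd]; module
  have key : ∀ t ∈ Set.Ioo (0 : ℝ) 1, (A t).det⁻¹ * ((A t).adjugate * laplacian d).trace ≤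
      inner ℝ (smoothGrad n lam₁ lam₂ γ w) d + inner ℝ (linearCoeff S lam₁) d +
        t * (lam₂ / 2 * ‖d‖ ^ 2) := by
    intro t ht
    have ht1 : 0 < 1 - t := sub_pos.2 ht.2
    have hwt : ∀ e, 0 ≤ (w + t • d) e := fun e => by
      rw [hcomb]
      exact add_nonneg (mul_nonneg ht1.le (hw0 e)) (mul_nonneg ht.1.le (hy e))
    -- `L y + J` may be singular, but for `t < 1` the positive definite matrix at `w` keeps positive
    -- weight.
    have hPD : (A t).PosDef := by
      have : A t = (1 - t) • (laplacian w + avgMatrix n) + t • (laplacian y + avgMatrix n) := by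
        have hyd : laplacian y = laplacian w + laplacian d := by
          have := laplacian_add_smul w d 1
          rwa [one_smul, one_smul, hd, add_sub_cancel] at this
        rw [hAt, hyd]
        module
      rw [this]
      exact (hA.smul ht1).add_posSemidef
        (((posSemidef_laplacian hy).add posSemidef_avgMatrix).smul ht.1.le)
    have h1 := hw (w + t • d)
    rw [cost_of_feasible hw0 hA, cost_of_feasible hwt hPD, EReal.coe_le_coe_iff] at h1
    have h2 := smoothPart_sub_le (lam₂ := lam₂) hlam₁ hγ w (w + t • d)
    rw [add_sub_cancel_left, inner_smul_right, norm_smul, mul_pow, Real.norm_eq_abs, sq_abs] at h2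
    -- The tangent is taken at `A t`, not at `A 0`: only then does concavity bound the change of
    -- `log det` in the direction needed. Letting `t` tend to 0 restores `A 0`.
    have h3 := log_det_le hPD hA
    have h4 : ((A t)⁻¹ * (laplacian w + avgMatrix n)).trace - Fintype.card (Fin n) =
        -(t * ((A t)⁻¹ * laplacian d).trace) := by
      have : laplacian w + avgMatrix n = A t - t • laplacian d := by rw [hAt]; abel
      rw [this, mul_sub, nonsing_inv_mul _ hPD.det_pos.ne'.isUnit, trace_sub, trace_one,
        mul_smul_comm, trace_smul, smul_eq_mul]
      ring
    rw [h4, inv_def, Ring.inverse_eq_inv', smul_mul_assoc, trace_smul, smul_eq_mul] at h3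
    rw [inner_add_right, inner_smul_right] at h1
    change _ ≤ _ - Real.log (A t).det at h1
    refine le_of_mul_le_mul_left ?_ ht.1
    linarith
  have hAc : Continuous A :=
    (continuous_laplacian.comp (by fun_prop : Continuous fun t : ℝ => w + t • d)).add
      continuous_const
  have hA0 : A 0 = laplacian w + avgMatrix n := by simp [A]
  -- The inverse is written as adjugate over determinant, so continuity is that of polynomials and
  -- one nonzero quotient.
  have hl : Tendsto (fun t => (A t).det⁻¹ * ((A t).adjugate * laplacian d).trace) (𝓝[>] 0)
      (𝓝 ((A 0).det⁻¹ * ((A 0).adjugate * laplacian d).trace)) := by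
    have h1 : Tendsto (fun t => (A t).det⁻¹) (𝓝 0) (𝓝 (A 0).det⁻¹) :=
      (hAc.matrix_det.tendsto 0).inv₀ (by rw [hA0]; exact hA.det_pos.ne')
    have h2 : Continuous fun t => ((A t).adjugate * laplacian d).trace :=
      (hAc.matrix_adjugate.matrix_mul continuous_const).matrix_trace
    exact (h1.mul (h2.tendsto 0)).mono_left nhdsWithin_le_nhds
  have hr : Tendsto (fun t : ℝ => inner ℝ (smoothGrad n lam₁ lam₂ γ w) d +
      inner ℝ (linearCoeff S lam₁) d + t * (lam₂ / 2 * ‖d‖ ^ 2)) (𝓝[>] 0)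
      (𝓝 (inner ℝ (smoothGrad n lam₁ lam₂ γ w) d + inner ℝ (linearCoeff S lam₁) d +
        0 * (lam₂ / 2 * ‖d‖ ^ 2))) :=
    (Continuous.tendsto (by fun_prop) 0).mono_left nhdsWithin_le_nhds
  have h := le_of_tendsto_of_tendsto hl hr
    (by filter_upwards [Ioo_mem_nhdsGT one_pos] with t ht using key t ht)
  rw [hA0, zero_mul, add_zero] at h
  rwa [inv_def, Ring.inverse_eq_inv', smul_mul_assoc, trace_smul, smul_eq_mul]

theorem IsGlobalMinimizer.exists_isSaddle {w : WeightSpace n}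
    (hw : IsGlobalMinimizer S lam₁ lam₂ γ w) (hlam₁ : 0 ≤ lam₁) (hγ : 0 < γ) :
    ∃ s, IsSaddle (smoothGrad n lam₁ lam₂ γ) (nonsmoothPart S lam₁) negLogDet
      (laplacianOp n) s := by
  obtain ⟨hw0, hA⟩ := hw.feasible
  refine ⟨(w, ofMat (-(laplacian w + avgMatrix n)⁻¹)),
    hasSubgradient_nonsmoothPart hw0 fun y hy => ?_, hasSubgradient_negLogDet hA ?_⟩
  · have h := hw.trace_inv_mul_laplacian_le hlam₁ hγ hy
    rw [inner_sub_left, inner_neg_left, ContinuousLinearMap.adjoint_inner_left,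
      inner_ofMat_laplacianOp, neg_mul, trace_neg]
    linarith
  · have h := hA.inv.isHermitian
    rw [IsHermitian, conjTranspose_eq_transpose_of_trivial] at h
    rw [toMat_ofMat, transpose_neg, h, toMat_laplacianOp]
    module

/-- Adding the subgradient inequalities of `F`, `G` and `H`, the linear terms cancel through the
adjoint. -/
theorem IsSaddle.isGlobalMinimizer (hlam₁ : 0 ≤ lam₁) (hγ : 0 < γ) (hconv : γ⁻¹ * lam₁ ≤ lam₂)
    {s : WeightSpace n × MatSpace n} (hs : IsSaddle (smoothGrad n lam₁ lam₂ γ)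
      (nonsmoothPart S lam₁) negLogDet (laplacianOp n) s) :
    IsGlobalMinimizer S lam₁ lam₂ γ s.1 := by
  obtain ⟨⟨a, ha, hG⟩, b, hb, hH⟩ := hs
  intro y
  have h1 := smoothPart_sub_nonneg hlam₁ hγ hconv s.1 y
  rw [cost, cost, ha, hb]
  refine le_of_eq_of_le ?_ (add_le_add (add_le_add (EReal.coe_le_coe_iff.2 h1) (hG y))
    (hH (laplacianOp n y)))
  simp only [← EReal.coe_add, EReal.coe_eq_coe_iff]
  rw [inner_sub_left, inner_neg_left, ContinuousLinearMap.adjoint_inner_left, map_sub]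
  ring

theorem exists_forall_ge_quadratic_le {a : ℝ} (ha : 0 < a) (k m : ℝ) :
    ∃ R, ∀ r, R ≤ r → k * r - a * r ^ 2 ≤ m := by
  refine ⟨max 1 ((|k| + |m|) / a), fun r hr => ?_⟩
  have h1 : 1 ≤ r := (le_max_left _ _).trans hr
  have h2 : |k| + |m| ≤ a * r := by
    have := (le_max_right _ _).trans hr
    rw [div_le_iff₀ ha] at this
    linarith
  have h3 := mul_le_mul_of_nonneg_right h2 (by linarith : 0 ≤ r)
  have h4 : |m| ≤ |m| * r := le_mul_of_one_le_right (abs_nonneg _) h1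
  have h5 := mul_le_mul_of_nonneg_right (le_abs_self k) (by linarith : 0 ≤ r)
  have h6 := neg_abs_le m
  linarith

/-- On the cone the l1 term dominates the subtracted Huber term, so the quadratic growth of `F`
survives. -/
theorem smoothPart_add_linear_ge (hlam₁ : 0 ≤ lam₁) (hγ : 0 < γ) {w : WeightSpace n}
    (hw : ∀ e, 0 ≤ w e) : lam₂ / 2 * ‖w‖ ^ 2 + inner ℝ (ofMat S) (laplacianOp n w) ≤
    smoothPart n lam₁ lam₂ γ w + inner ℝ (linearCoeff S lam₁) w := by
  have h : ∑ e, huber γ (w e) ≤ ∑ e, w e := Finset.sum_le_sum fun e _ =>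
    (huber_le_abs hγ _).trans_eq (abs_of_nonneg (hw e))
  have := mul_le_mul_of_nonneg_left h hlam₁
  rw [inner_linearCoeff, smoothPart, moreauEnvelope_l1norm hγ, inner_matSpace_eq_sum,
    toMat_ofMat, toMat_laplacianOp]
  linarith

/-- Minimizing the cost is maximizing `φ = exp (-cost)`, which extends continuously by `det` to the
boundary of the positive definite cone, where the cost is infinite. -/
theorem exists_isGlobalMinimizer (hlam₁ : 0 ≤ lam₁) (hlam₂ : 0 < lam₂) (hγ : 0 < γ)
    (hconv : γ⁻¹ * lam₁ ≤ lam₂) : ∃ w, IsGlobalMinimizer S lam₁ lam₂ γ w := by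
  let h : WeightSpace n → ℝ := fun w =>
    smoothPart n lam₁ lam₂ γ w + inner ℝ (linearCoeff S lam₁) w
  let φ : WeightSpace n → ℝ := fun w => (laplacian w + avgMatrix n).det * Real.exp (-h w)
  have hPSD : ∀ w : WeightSpace n, (∀ e, 0 ≤ w e) → (laplacian w + avgMatrix n).PosSemidef :=
    fun w hw => (posSemidef_laplacian hw).add posSemidef_avgMatrix
  have hFc : Continuous (smoothPart n lam₁ lam₂ γ) := continuous_iff_continuousAt.2 fun w =>
    (hasGradientAt_smoothPart hlam₁ hγ hconv w).continuousAt
  have hφc : Continuous φ :=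
    (continuous_laplacian.add continuous_const).matrix_det.mul (by fun_prop)
  have hclosed : IsClosed {w : WeightSpace n | ∀ e, 0 ≤ w e} := by
    rw [Set.ofPred_forall]
    exact isClosed_iInter fun e => isClosed_le continuous_const (by fun_prop)
  set w₁ := uniformWeight n with hw₁
  have hdet₁ : (laplacian w₁ + avgMatrix n).det = 1 := by
    rw [laplacian_uniformWeight, det_one]
  -- Far out, `log det` is bounded by the trace. Together with `-⟨S, L w⟩` this gives `⟨1 - S, L
  -- w⟩`, linear in `w` and beaten by the quadratic term.
  let v : MatSpace n := ofMat (1 - S)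
  obtain ⟨R, hR⟩ := exists_forall_ge_quadratic_le (a := lam₂ / 2) (by positivity)
    (‖ContinuousLinearMap.adjoint (laplacianOp n) v‖)
    (-h w₁ - ((avgMatrix n).trace - Fintype.card (Fin n)))
  have hfar : ∀ w : WeightSpace n, (∀ e, 0 ≤ w e) → R ≤ ‖w‖ → φ w ≤ φ w₁ := by
    intro w hw hRw
    have h1 := det_le_exp_trace (hPSD w hw)
    have h2 : φ w ≤ Real.exp ((laplacian w + avgMatrix n).trace - Fintype.card (Fin n) - h w) := by
      rw [sub_eq_add_neg _ (h w), Real.exp_add]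
      exact mul_le_mul_of_nonneg_right h1 (Real.exp_pos _).le
    have h3 : φ w₁ = Real.exp (-h w₁) := by simp only [φ, hdet₁, one_mul]
    rw [h3]
    refine h2.trans (Real.exp_le_exp.2 ?_)
    have h4 : inner ℝ (ofMat (1 - S)) (laplacianOp n w) =
        (laplacian w).trace - inner ℝ (ofMat S) (laplacianOp n w) := by
      rw [inner_ofMat_laplacianOp, inner_ofMat_laplacianOp, sub_mul, one_mul,
        trace_sub]
    have h5 := real_inner_le_norm (ContinuousLinearMap.adjoint (laplacianOp n) v) w
    rw [ContinuousLinearMap.adjoint_inner_left] at h5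
    have h6 := smoothPart_add_linear_ge (S := S) (lam₂ := lam₂) hlam₁ hγ hw
    have h7 := hR _ hRw
    rw [trace_add]
    change _ ≤ h w at h6
    linarith
  obtain ⟨w, hw, hmax⟩ := hφc.continuousOn.exists_isMaxOn' hclosed (x₀ := w₁)
    uniformWeight_nonneg (by
      rw [eventually_inf_principal]
      filter_upwards [tendsto_norm_cocompact_atTop.eventually_ge_atTop R] with w hRw hw
        using hfar w hw hRw)
  -- The maximum is at least the positive value at the uniform weights, so the determinant is
  -- positive and the semidefinite matrix definite.
  have hpos : 0 < (laplacian w + avgMatrix n).det := by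
    have h1 : φ w₁ ≤ φ w := hmax uniformWeight_nonneg
    have h2 : 0 < φ w₁ := mul_pos (by rw [hdet₁]; exact one_pos) (Real.exp_pos _)
    exact (mul_pos_iff_of_pos_right (Real.exp_pos _)).1 (h2.trans_le h1)
  refine ⟨w, fun y => ?_⟩
  by_cases hy : (∀ e, 0 ≤ y e) ∧ (laplacian y + avgMatrix n).PosDef
  · rw [cost_of_feasible hy.1 hy.2, cost_of_feasible hw
      ((hPSD w hw).posDef_iff_det_ne_zero.2 hpos.ne'), EReal.coe_le_coe_iff]
    have h1 : φ y ≤ φ w := hmax hy.1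
    have h2 := Real.log_le_log (mul_pos hy.2.det_pos (Real.exp_pos _)) h1
    rw [Real.log_mul hy.2.det_pos.ne' (Real.exp_pos _).ne', Real.log_exp,
      Real.log_mul hpos.ne' (Real.exp_pos _).ne', Real.log_exp] at h2
    simp only [h] at h2
    linarith
  · rw [cost_of_not_feasible hy]
    exact le_top

end Minimizers

end GraphLearning

end

/-! ### The main theorem. -/

theorem proposition4 (n : ℕ) (S : Matrix (Fin n) (Fin n) ℝ) (lam₁ lam₂ γ : ℝ)
    (hlam₁ : 0 ≤ lam₁) (hlam₂ : 0 ≤ lam₂) (hγ : 0 < γ) (hconv : γ⁻¹ * lam₁ ≤ lam₂) :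
    ConvexOn ℝ Set.univ (GraphLearning.smoothPart n lam₁ lam₂ γ) ∧
    Differentiable ℝ (GraphLearning.smoothPart n lam₁ lam₂ γ) ∧
    LipschitzWith lam₂.toNNReal (gradient (GraphLearning.smoothPart n lam₁ lam₂ γ)) ∧
    (2 ≤ n → ‖GraphLearning.laplacianOp n‖ ^ 2 = 2 * (n : ℝ)) ∧
    ∀ (τ σ : ℝ) (ρ : ℕ → ℝ), 0 < τ → 0 < σ →
      2 * σ * n + lam₂ / 2 ≤ 1 / τ →
      -- the inverse in the bound on `ρ` exists (automatic if `lam₂ > 0`)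
      2 * σ * n < 1 / τ →
      (∀ k, 0 < ρ k ∧ ρ k < 2 - lam₂ / 2 * (1 / τ - 2 * σ * n)⁻¹) →
      -- the relaxation does not degenerate, e.g. if `ρ` is constant
      ¬ Summable (fun k => ρ k * (2 - lam₂ / 2 * (1 / τ - 2 * σ * n)⁻¹ - ρ k)) →
      -- without any regularization the problem has to be solvable
      (lam₂ = 0 → ∃ w, GraphLearning.IsGlobalMinimizer S lam₁ lam₂ γ w) →
      ∀ (w₀ : GraphLearning.WeightSpace n) (V₀ : GraphLearning.MatSpace n),
        ∃ w : GraphLearning.WeightSpace n,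
          GraphLearning.IsGlobalMinimizer S lam₁ lam₂ γ w ∧
          Tendsto (fun k => (GraphLearning.pdsIter (GraphLearning.smoothPart n lam₁ lam₂ γ)
            (GraphLearning.nonsmoothPart S lam₁) GraphLearning.negLogDet
            (GraphLearning.laplacianOp n) τ σ ρ (w₀, V₀) k).1) atTop (𝓝 w) := by
  refine ⟨GraphLearning.convexOn_smoothPart hlam₁ hγ hconv,
    fun w => (GraphLearning.hasGradientAt_smoothPart hlam₁ hγ hconv w).differentiableAt, ?_,
    GraphLearning.norm_laplacianOp_sq_eq, ?_⟩
  · rw [GraphLearning.gradient_smoothPart hlam₁ hγ hconv]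
    exact GraphLearning.lipschitzWith_smoothGrad hlam₁ hlam₂ hγ hconv
  intro τ σ ρ hτ hσ _ hστ hρ hsum hmin w₀ V₀
  have hgrad := GraphLearning.gradient_smoothPart (n := n) hlam₁ hγ hconv
  have hex : ∃ w, GraphLearning.IsGlobalMinimizer S lam₁ lam₂ γ w := by
    rcases hlam₂.eq_or_lt with h | h
    · exact hmin h.symm
    · exact GraphLearning.exists_isGlobalMinimizer hlam₁ h hγ hconv
  obtain ⟨w, hw⟩ := hex
  have e : 1 / τ - 2 * σ * n = τ⁻¹ - σ * (2 * n) := by ring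
  rw [e] at hρ hsum
  obtain ⟨s, hs, hlim⟩ := GraphLearning.exists_tendsto_pdsIter
    (F := GraphLearning.smoothPart n lam₁ lam₂ γ) (G := GraphLearning.nonsmoothPart S lam₁)
    (H := GraphLearning.negLogDet) (L := GraphLearning.laplacianOp n) hσ hτ hlam₂
    GraphLearning.norm_laplacianOp_sq_le_two_mul (by linarith)
    (by rw [hgrad]; exact GraphLearning.smoothGrad_cocoercive hlam₁ hlam₂ hγ hconv)
    (by rw [hgrad]; exact (GraphLearning.lipschitzWith_smoothGrad hlam₁ hlam₂ hγ hconv).continuous)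
    (GraphLearning.exists_resolvent_nonsmoothPart hτ)
    (GraphLearning.exists_resolvent_negLogDet hσ) hρ hsum
    (by rw [hgrad]; exact hw.exists_isSaddle hlam₁ hγ) (w₀, V₀)
  rw [hgrad] at hs
  exact ⟨s.1, hs.isGlobalMinimizer hlam₁ hγ hconv, (continuous_fst.tendsto s).comp hlim⟩
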